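/- In the online prize-collecting Steiner forest problem there is an underlying metric space $(V,d)$, viewed as the complete graph on $V$ in which the edge $uv$ has length $d(u,v)$; it is not known to the algorithm in advance. Requests arrive one by one; the $i$-th request is a pair $(s_i,t_i)$ of terminals in $V$ with a penalty $\pi_i\ge 0$. When it arrives, the algorithm learns $\pi_i$ and the distances between the terminals that have arrived so far. The algorithm maintains a subgraph $H$ (initially empty): it may add to $H$ edges between arrived terminals, and it must either pay the penalty $\pi_i$ or make sure that $s_i$ and $t_i$ are connected in $H$ at the end of the step. All decisions are irrevocable: edges are never removed from $H$ and penalties that have been paid are never refunded. The total cost of the algorithm is $c(H)+\sum_{i\in P}\pi_i$, where $c(H)$ is the total length of the edges of $H$ and $P$ is the set of requests whose penalty was paid. Theorem. There are a deterministic online algorithm for this problem and an absolute constant $C$ such that, for every metric space and every finite request sequence, the algorithm handles every request as required and its total cost is at most $C\log k\cdot\mathrm{OPT}$. Here $k$ is the number of distinct terminals in the request sequence (the factor $\log k$ is read as $0$ if there are no requests), and $\mathrm{OPT}$ is the optimal offline cost, that is, the infimum of $c(F)+\sum_{i\in Q}\pi_i$ over all finite edge sets $F$ of the complete graph on $V$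 and all sets $Q$ of requests such that $s_i$ and $t_i$ are connected by $F$ for every $i\notin Q$. -/

import Mathlib

noncomputable section

namespace PCSF

/-! ### Instances and offline solutions -/

/-- Length of an (unordered) edge of the complete graph on a metric space. -/
def edgeLength {V : Type*} [MetricSpace V] : Sym2 V → ℝ :=
  Sym2.lift ⟨fun u v => dist u v, fun u v => dist_comm u v⟩

/-- The cost of a subgraph, given by its finite edge set: the sum of the lengths of its edges. -/
def edgeCost {V : Type*} [MetricSpace V] (H : Finset (Sym2 V)) : ℝ :=
  ∑ e ∈ H, edgeLength e

/-- `u` and `v` are connected in the subgraph with edge set `H`. -/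
def Connects {V : Type*} (H : Finset (Sym2 V)) (u v : V) : Prop :=
  (SimpleGraph.fromEdgeSet (H : Set (Sym2 V))).Reachable u v

/-- A finite sequence of requests: the pairs `(s i, t i)` with penalties, in order of arrival. -/
structure Instance (V : Type*) where
  len : ℕ
  s : Fin len → V
  t : Fin len → V
  penalty : Fin len → NNReal

namespace Instance

variable {V : Type*}

/-- The terminals of the requests: `(i, false)` stands for `s i` and `(i, true)` for `t i`. -/
def terminal (I : Instance V) : Fin I.len × Bool → V
  | (i, false) => I.s i
  | (i, true) => I.t i

open Classical in
/-- The number of (distinct) terminals. -/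
def numTerminals (I : Instance V) : ℕ :=
  (Finset.univ.image I.terminal).card

/-- The first `m` requests. -/
def take (I : Instance V) (m : ℕ) (h : m ≤ I.len) : Instance V where
  len := m
  s i := I.s (Fin.castLE h i)
  t i := I.t (Fin.castLE h i)
  penalty i := I.penalty (Fin.castLE h i)

/-- An offline solution: a subgraph `H` of the complete graph on all of `V` and a set `P` of
requests whose penalty is paid; all other pairs are connected in `H`. -/
def IsSolution (I : Instance V) (H : Finset (Sym2 V)) (P : Finset (Fin I.len)) : Prop :=
  ∀ i, i ∉ P → Connects H (I.s i) (I.t i)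

/-- The cost of a subgraph and a set of paid penalties. -/
def solutionCost [MetricSpace V] (I : Instance V) (H : Finset (Sym2 V))
    (P : Finset (Fin I.len)) : ℝ :=
  edgeCost H + ∑ i ∈ P, (I.penalty i : ℝ)

/-- The cost of an optimal offline solution. -/
def opt [MetricSpace V] (I : Instance V) : ℝ :=
  sInf {c | ∃ H P, I.IsSolution H P ∧ c = I.solutionCost H P}

end Instance

/-! ### Deterministic online algorithms -/

/-- What is revealed by the first `n` requests: the distances between the terminals that have
arrived, and the penalties. -/
structure Observation (n : ℕ) where
  distance : Fin n × Bool → Fin n × Bool → ℝ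
  penalty : Fin n → NNReal

/-- What is done in the step of the `n`-th request: a set of edges between terminals that have
arrived is bought, and the penalty of this request is paid or not. -/
structure Decision (n : ℕ) where
  buy : Finset (Sym2 (Fin n × Bool))
  pay : Bool

/-- A deterministic online algorithm: the decision on each request is a function of what has been
revealed up to and including this request. -/
def OnlineAlgorithm : Type := (n : ℕ) → Observation (n + 1) → Decision (n + 1)

/-- What all the requests of a sequence reveal. -/
def Instance.observe {V : Type*} [MetricSpace V] (I : Instance V) : Observation I.len where
  distance p q := dist (I.terminal p) (I.terminal q)
  penalty := I.penalty

namespace OnlineAlgorithm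

variable {V : Type*} [MetricSpace V]

/-- The decision that the algorithm takes when request `i` arrives. -/
def decision (A : OnlineAlgorithm) (I : Instance V) (i : Fin I.len) : Decision (i + 1) :=
  A i (I.take (i + 1) i.isLt).observe

open Classical in
/-- The edges that are bought when request `i` arrives, as edges of the complete graph on `V`. -/
def bought (A : OnlineAlgorithm) (I : Instance V) (i : Fin I.len) : Finset (Sym2 V) :=
  (A.decision I i).buy.image (Sym2.map (I.take (i + 1) i.isLt).terminal)

open Classical in
/-- The subgraph maintained by the algorithm, after the first `m` requests. Edges are only added. -/
def subgraph (A : OnlineAlgorithm) (I : Instance V) (m : ℕ) : Finset (Sym2 V) :=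
  (Finset.univ.filter fun i : Fin I.len => (i : ℕ) < m).biUnion (A.bought I)

/-- The requests whose penalty the algorithm pays. -/
def paid (A : OnlineAlgorithm) (I : Instance V) : Finset (Fin I.len) :=
  Finset.univ.filter fun i => (A.decision I i).pay = true

/-- In the step of each request, the algorithm pays the penalty, or else the pair is connected in
the subgraph maintained by the algorithm at the end of this step. -/
def IsFeasible (A : OnlineAlgorithm) (I : Instance V) : Prop :=
  ∀ i : Fin I.len, i ∉ A.paid I → Connects (A.subgraph I (i + 1)) (I.s i) (I.t i)

/-- The total cost of the algorithm. -/
def cost (A : OnlineAlgorithm) (I : Instance V) : ℝ :=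
  I.solutionCost (A.subgraph I I.len) (A.paid I)

end OnlineAlgorithm

end PCSF

end

/-! The algorithm grows moats around clusters of terminals at the scales 2^j. A live cluster of
level j holds credit 2^j and has a current moat of capacity 2^j. Clusters within 2^j of each other,
where j is the lower of the two levels, are merged, and the credit of the lower one buys the edge.
When a moat is full the cluster rises one level, and the contents of the moat pay for doubling the
credit. If the terminals of a new request still lie in different clusters, the one of lower level
charges the moat of its cluster. Either the whole penalty fits, and the penalty is charged and paid,
or the moat is filled up and the cluster rises. Hence edges and penalties are each bounded by the
total charge, up to a small allowance for the initial credits (`clusterAlgorithm_cost_le`).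

It remains to compare the charges with an offline solution of cost X. Charges at level j to
different moats come from terminals more than 2^j apart, and each of these terminals is more than
2^j from its partner. If the solution connects the pairs, it must leave disjoint balls of radius
2^j/2, so the number of such moats times 2^j is at most four times its edge cost. If it pays a
penalty instead, each of the two terminals has charged at most that penalty at level j. So every
level carries O(X) (`Invariant.levelSum_le`).

A level is reached only from an initial level below X or by filling a moat one level lower, so 2^j =
O(X) for every level in use (`Invariant.two_zpow_le_cost`). There are at most k moats per level, so
the levels with 2^j below X/k contribute O(X) in total, as a geometric series. Only O(log k) levels
are left between these bounds (`sum_levels_le`). -/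

noncomputable section

namespace PCSF

/-! ### Clusterings of the arrived terminals -/

/-- The state of the algorithm. Requests are numbered, and `(i, false)`, `(i, true)` are the
terminals of request `i`. The arrived terminals are partitioned into clusters with labels in
`live`, and every label has a level. A charge `(p, j)` records that at level `j` the terminal `p`
has contributed `amount (p, j)` to the moat named `atom (p, j)`. -/
structure ClusterState where
  edges : Finset ((ℕ × Bool) × (ℕ × Bool))
  paid : Finset ℕ
  arrived : Finset (ℕ × Bool)
  live : Finset (ℕ × Bool)
  cluster : ℕ × Bool → ℕ × Bool
  level : ℕ × Bool → ℤ
  charges : Finset ((ℕ × Bool) × ℤ)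
  amount : (ℕ × Bool) × ℤ → ℝ
  atom : (ℕ × Bool) × ℤ → ℕ × Bool

namespace ClusterState

/-- What has been charged to the moat `a` of level `j`. -/
def atomSum (σ : ClusterState) (a : ℕ × Bool) (j : ℤ) : ℝ :=
  ∑ e ∈ σ.charges with e.2 = j ∧ σ.atom e = a, σ.amount e

/-- What has been charged at level `j`. -/
def levelSum (σ : ClusterState) (j : ℤ) : ℝ :=
  ∑ e ∈ σ.charges with e.2 = j, σ.amount e

/-- What has been charged by the terminals of request `i`. -/
def requestSum (σ : ClusterState) (i : ℕ) : ℝ :=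
  ∑ e ∈ σ.charges with e.1.1 = i, σ.amount e

/-- What has been charged to the moats of the live clusters at their current levels. -/
def openSum (σ : ClusterState) : ℝ :=
  ∑ e ∈ σ.charges with σ.atom e ∈ σ.live ∧ e.2 = σ.level (σ.atom e), σ.amount e

/-- Connectivity in the subgraph that has been bought. -/
def Joined (σ : ClusterState) (p q : ℕ × Bool) : Prop :=
  Relation.EqvGen (fun u v => (u, v) ∈ σ.edges) p q

/-- The state `τ` is reached from `σ` without revoking a decision. -/
structure Extends (σ τ : ClusterState) : Prop where
  edges : σ.edges ⊆ τ.edges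
  paid : σ.paid ⊆ τ.paid
  arrived : σ.arrived ⊆ τ.arrived
  level : ∀ p ∈ σ.arrived, σ.level (σ.cluster p) ≤ τ.level (τ.cluster p)

theorem Extends.refl (σ : ClusterState) : σ.Extends σ :=
  ⟨subset_rfl, subset_rfl, subset_rfl, fun _ _ => le_rfl⟩

theorem Extends.trans {σ τ υ : ClusterState} (h : σ.Extends τ) (h' : τ.Extends υ) :
    σ.Extends υ :=
  ⟨h.edges.trans h'.edges, h.paid.trans h'.paid, h.arrived.trans h'.arrived,
    fun p hp => (h.level p hp).trans (h'.level p (h.arrived hp))⟩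

end ClusterState

/-- The other terminal of the same request. -/
def partner (p : ℕ × Bool) : ℕ × Bool := (p.1, !p.2)

/-- The smaller one of the penalty of a request and the distance of its terminals. -/
def threshold (D : ℕ × Bool → ℕ × Bool → ℝ) (pen : ℕ → ℝ) (i : ℕ) : ℝ :=
  min (pen i) (D (i, false) (i, true))

/-- An allowance for the initial levels of the terminals of the first `m` requests. -/
def allowance (D : ℕ × Bool → ℕ × Bool → ℝ) (pen : ℕ → ℝ) (m : ℕ) : ℝ :=
  ∑ i ∈ Finset.range m, 2 * (threshold D pen i * (1 / 2) ^ (i + 1))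

/-! ### The invariant and the conditions between steps -/

open ClusterState

/-- The invariant of the algorithm, in terms of the distances and penalties of the first `m`
requests. -/
structure Invariant (D : ℕ × Bool → ℕ × Bool → ℝ) (pen : ℕ → ℝ) (m : ℕ)
    (σ : ClusterState) : Prop where
  arrived_lt : ∀ p ∈ σ.arrived, p.1 < m
  live_lt : ∀ a ∈ σ.live, a.1 < m
  edges_lt : ∀ e ∈ σ.edges, e.1.1 < m ∧ e.2.1 < m
  atom_lt : ∀ e ∈ σ.charges, (σ.atom e).1 < m
  charge_arrived : ∀ e ∈ σ.charges, e.1 ∈ σ.arrived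
  cluster_live : ∀ p ∈ σ.arrived, σ.cluster p ∈ σ.live
  joined : ∀ p ∈ σ.arrived, ∀ q ∈ σ.arrived, σ.cluster p = σ.cluster q → σ.Joined p q
  charge_le : ∀ e ∈ σ.charges, e.2 ≤ σ.level (σ.cluster e.1)
  -- A cluster has only one moat at its current level. This turns separation of clusters into
  -- separation of moats.
  charge_eq : ∀ e ∈ σ.charges, e.2 = σ.level (σ.cluster e.1) → σ.atom e = σ.cluster e.1
  charge_le_atom : ∀ e ∈ σ.charges, e.2 ≤ σ.level (σ.atom e)
  separated : ∀ e ∈ σ.charges, ∀ f ∈ σ.charges, e.2 = f.2 → σ.atom e ≠ σ.atom f →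
    (2 : ℝ) ^ e.2 < D e.1 f.1
  -- An offline solution that connects the pair has to leave the ball of radius 2^j around the
  -- charged terminal.
  far : ∀ e ∈ σ.charges, (2 : ℝ) ^ e.2 < D e.1 (partner e.1)
  amount_nonneg : ∀ e ∈ σ.charges, 0 ≤ σ.amount e
  amount_le : ∀ e ∈ σ.charges, σ.amount e ≤ pen e.1.1
  -- The capacity is 2^j, but two moats that are each within capacity may be united by a merge.
  atomSum_le : ∀ a j, σ.atomSum a j ≤ 2 * 2 ^ j
  paid_lt : ∀ i ∈ σ.paid, i < m
  paid_le : ∀ i ∈ σ.paid, pen i ≤ σ.requestSum i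
  -- Potential argument: a live cluster owns 2^level and the contents of its current moat; charges
  -- and the allowance are the only income.
  credit : ∑ e ∈ σ.edges, D e.1 e.2 + ∑ a ∈ σ.live, (2 : ℝ) ^ σ.level a + σ.openSum ≤
    allowance D pen m + ∑ e ∈ σ.charges, σ.amount e
  -- This traces every level back to a threshold or to a full moat one level below, which bounds the
  -- highest level by the offline cost.
  live_reason : ∀ a ∈ σ.live, (∃ i < m, (2 : ℝ) ^ σ.level a ≤ threshold D pen i) ∨
    (2 : ℝ) ^ (σ.level a - 1) ≤ σ.levelSum (σ.level a - 1)
  charge_reason : ∀ e ∈ σ.charges, (∃ i < m, (2 : ℝ) ^ e.2 ≤ threshold D pen i) ∨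
    (2 : ℝ) ^ (e.2 - 1) ≤ σ.levelSum (e.2 - 1)

/-- No live cluster has a moat that is more than full. -/
def ClusterState.Tight (σ : ClusterState) : Prop :=
  ∀ a ∈ σ.live, σ.atomSum a (σ.level a) ≤ 2 ^ σ.level a

/-- Any two clusters are farther apart than the moats of the lower level of the two. -/
def ClusterState.Settled (D : ℕ × Bool → ℕ × Bool → ℝ) (σ : ClusterState) : Prop :=
  ∀ p ∈ σ.arrived, ∀ q ∈ σ.arrived, σ.cluster p ≠ σ.cluster q →
    (2 : ℝ) ^ min (σ.level (σ.cluster p)) (σ.level (σ.cluster q)) < D p q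

/-- The charges of request `n` are at levels that its terminals have left. -/
def ClusterState.Fresh (n : ℕ) (σ : ClusterState) : Prop :=
  ∀ e ∈ σ.charges, e.1.1 = n → e.2 < σ.level (σ.cluster e.1)

section Operations

variable {D : ℕ × Bool → ℕ × Bool → ℝ} {pen : ℕ → ℝ} {m : ℕ} {σ : ClusterState}

theorem Invariant.atomSum_le_levelSum (h : Invariant D pen m σ) (a : ℕ × Bool) (j : ℤ) :
    σ.atomSum a j ≤ σ.levelSum j := by
  refine Finset.sum_le_sum_of_subset_of_nonneg ?_ fun e he _ =>
    h.amount_nonneg e (Finset.mem_filter.1 he).1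
  intro e he
  simp only [Finset.mem_filter] at he ⊢
  exact ⟨he.1, he.2.1⟩

/-! ### Raising the level of a cluster -/

/-- Raise the level of the cluster `a` by one. -/
def ClusterState.levelUp (σ : ClusterState) (a : ℕ × Bool) : ClusterState :=
  { σ with level := Function.update σ.level a (σ.level a + 1) }

theorem level_le_levelUp (σ : ClusterState) (a x : ℕ × Bool) :
    σ.level x ≤ (σ.levelUp a).level x := by
  by_cases hx : x = a
  · subst hx; simp [levelUp]
  · simp [levelUp, hx]

theorem extends_levelUp (σ : ClusterState) (a : ℕ × Bool) : σ.Extends (σ.levelUp a) :=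
  ⟨subset_rfl, subset_rfl, subset_rfl, fun _ _ => level_le_levelUp σ a _⟩

theorem Invariant.atomSum_levelUp (h : Invariant D pen m σ) (a : ℕ × Bool) :
    (σ.levelUp a).atomSum a ((σ.levelUp a).level a) = 0 := by
  refine Finset.sum_eq_zero fun e he => ?_
  simp only [Finset.mem_filter, levelUp, Function.update_self] at he
  have := h.charge_le_atom e he.1
  rw [he.2.2] at this
  omega

/-- Raising the level closes the current moat. Its contents, at least 2^level, leave `openSum` and
pay for the credit growing from 2^level to 2^(level+1). -/
theorem Invariant.levelUp (h : Invariant D pen m σ) {a : ℕ × Bool} (ha : a ∈ σ.live)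
    (hfull : (2 : ℝ) ^ σ.level a ≤ σ.atomSum a (σ.level a)) :
    Invariant D pen m (σ.levelUp a) where
  arrived_lt := h.arrived_lt
  live_lt := h.live_lt
  edges_lt := h.edges_lt
  atom_lt := h.atom_lt
  charge_arrived := h.charge_arrived
  cluster_live := h.cluster_live
  joined := h.joined
  charge_le e he := (h.charge_le e he).trans (level_le_levelUp σ a _)
  charge_eq e he heq := by
    by_cases hx : σ.cluster e.1 = a
    · have h1 := h.charge_le e he
      simp only [ClusterState.levelUp, hx, Function.update_self] at heq
      rw [hx] at h1
      omega
    · refine h.charge_eq e he ?_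
      simpa [ClusterState.levelUp, hx] using heq
  charge_le_atom e he := (h.charge_le_atom e he).trans (level_le_levelUp σ a _)
  separated := h.separated
  far := h.far
  amount_nonneg := h.amount_nonneg
  amount_le := h.amount_le
  atomSum_le := h.atomSum_le
  paid_lt := h.paid_lt
  paid_le := h.paid_le
  credit := by
    have h1 : ∑ x ∈ σ.live, (2 : ℝ) ^ (σ.levelUp a).level x =
        ∑ x ∈ σ.live, (2 : ℝ) ^ σ.level x + 2 ^ σ.level a := by
      rw [← Finset.add_sum_erase _ _ ha, ← Finset.add_sum_erase σ.live _ ha]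
      have : ∑ x ∈ σ.live.erase a, (2 : ℝ) ^ (σ.levelUp a).level x =
          ∑ x ∈ σ.live.erase a, (2 : ℝ) ^ σ.level x := by
        refine Finset.sum_congr rfl fun x hx => ?_
        simp [ClusterState.levelUp, Finset.ne_of_mem_erase hx]
      rw [this]
      simp only [ClusterState.levelUp, Function.update_self]
      rw [zpow_add_one₀ (by norm_num)]
      ring
    have h2 : (σ.levelUp a).openSum + σ.atomSum a (σ.level a) ≤ σ.openSum := by
      change ∑ e ∈ σ.charges with σ.atom e ∈ σ.live ∧ e.2 = (σ.levelUp a).level (σ.atom e),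
        σ.amount e + ∑ e ∈ σ.charges with e.2 = σ.level a ∧ σ.atom e = a, σ.amount e ≤ _
      rw [← Finset.sum_union]
      · refine Finset.sum_le_sum_of_subset_of_nonneg ?_ fun e he _ =>
          h.amount_nonneg e (Finset.mem_filter.1 he).1
        intro e he
        simp only [Finset.mem_union, Finset.mem_filter] at he ⊢
        simp only [ClusterState.levelUp] at he
        rcases he with ⟨he, hl, hj⟩ | ⟨he, hj, hx⟩
        · refine ⟨he, hl, ?_⟩
          by_cases hx : σ.atom e = a
          · have := h.charge_le_atom e he
            rw [hx] at this hj
            simp only [Function.update_self] at hj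
            omega
          · simpa [hx] using hj
        · exact ⟨he, hx ▸ ha, by rw [hx, hj]⟩
      · rw [Finset.disjoint_left]
        intro e he he'
        rw [Finset.mem_filter] at he he'
        simp only [ClusterState.levelUp] at he
        have := he.2.2
        rw [he'.2.2, Function.update_self, he'.2.1] at this
        omega
    have h3 := h.credit
    change ∑ e ∈ σ.edges, D e.1 e.2 + ∑ x ∈ σ.live, (2 : ℝ) ^ (σ.levelUp a).level x +
      (σ.levelUp a).openSum ≤ allowance D pen m + ∑ e ∈ σ.charges, σ.amount e
    linarith
  live_reason x hx := by
    by_cases hxa : x = a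
    · subst hxa
      right
      simp only [ClusterState.levelUp, Function.update_self, add_sub_cancel_right]
      exact hfull.trans (h.atomSum_le_levelSum _ _)
    · have hl : (σ.levelUp a).level x = σ.level x := by simp [ClusterState.levelUp, hxa]
      rw [hl]
      exact h.live_reason x hx
  charge_reason := h.charge_reason

/-! ### Merging two clusters -/

/-- Buy the edge `uv` and merge the cluster `a` into the cluster `b`. If they have the same
level, so do their moats. -/
def ClusterState.merge (σ : ClusterState) (u v a b : ℕ × Bool) : ClusterState :=
  { σ with
    edges := insert (u, v) σ.edges
    live := σ.live.erase a
    cluster := fun x => if σ.cluster x = a then b else σ.cluster x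
    atom := fun e => if e.2 = σ.level a ∧ e.2 = σ.level b ∧ σ.atom e = a then b else σ.atom e }

theorem extends_merge (σ : ClusterState) (u v : ℕ × Bool) {a b : ℕ × Bool}
    (hab : σ.level a ≤ σ.level b) : σ.Extends (σ.merge u v a b) := by
  refine ⟨Finset.subset_insert _ _, subset_rfl, subset_rfl, fun p _ => ?_⟩
  by_cases hp : σ.cluster p = a
  · simpa [ClusterState.merge, hp] using hab
  · simp [ClusterState.merge, hp]

theorem Joined.mono {σ τ : ClusterState} (h : σ.edges ⊆ τ.edges) {p q : ℕ × Bool}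
    (hpq : σ.Joined p q) : τ.Joined p q :=
  Relation.EqvGen.mono (fun _ _ huv => h huv) _ _ hpq

theorem merge_atom (σ : ClusterState) (u v a b : ℕ × Bool) (e : (ℕ × Bool) × ℤ) :
    (σ.merge u v a b).atom e =
      if e.2 = σ.level a ∧ e.2 = σ.level b ∧ σ.atom e = a then b else σ.atom e := rfl

theorem Invariant.atomSum_merge_le (h : Invariant D pen m σ) (u v a b x : ℕ × Bool) (j : ℤ) :
    (σ.merge u v a b).atomSum x j ≤ σ.atomSum x j +
      if x = b ∧ j = σ.level a ∧ j = σ.level b then σ.atomSum a j else 0 := by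
  unfold ClusterState.atomSum
  split_ifs with hc
  · obtain ⟨rfl, hja, hjb⟩ := hc
    refine le_trans (Finset.sum_le_sum_of_subset_of_nonneg (t := 
      {e ∈ σ.charges | e.2 = j ∧ σ.atom e = x} ∪ {e ∈ σ.charges | e.2 = j ∧ σ.atom e = a})
      ?_ ?_) ?_
    · intro e he
      rw [Finset.mem_filter, merge_atom] at he
      simp only [Finset.mem_union, Finset.mem_filter]
      split_ifs at he with h1
      · exact Or.inr ⟨he.1, he.2.1, h1.2.2⟩
      · exact Or.inl he
    · intro e he _
      simp only [Finset.mem_union, Finset.mem_filter] at he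
      exact h.amount_nonneg e (he.elim (·.1) (·.1))
    · have := Finset.sum_union_inter (s₁ := {e ∈ σ.charges | e.2 = j ∧ σ.atom e = x})
        (s₂ := {e ∈ σ.charges | e.2 = j ∧ σ.atom e = a}) (f := σ.amount)
      rw [← this]
      refine le_add_of_nonneg_right (Finset.sum_nonneg fun e he => ?_)
      simp only [Finset.mem_inter, Finset.mem_filter] at he
      exact h.amount_nonneg e he.1.1
  · rw [add_zero]
    refine Finset.sum_le_sum_of_subset_of_nonneg ?_ fun e he _ =>
      h.amount_nonneg e (Finset.mem_filter.1 he).1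
    intro e he
    rw [Finset.mem_filter, merge_atom] at he
    rw [Finset.mem_filter]
    split_ifs at he with h1
    · exact absurd ⟨he.2.2.symm, he.2.1 ▸ h1.1, he.2.1 ▸ h1.2.1⟩ hc
    · exact he

/-- The cluster `a` disappears and its credit 2^level pays for the edge. At equal levels the two
moats must be united to keep one moat per cluster and level; tightness of both gives the bound
2·2^j. At different levels the moat of `a` is closed. -/
theorem Invariant.merge (h : Invariant D pen m σ) (ht : σ.Tight)
    {u v a b : ℕ × Bool} (hu : u ∈ σ.arrived) (hv : v ∈ σ.arrived)
    (huv : σ.cluster u = a ∧ σ.cluster v = b ∨ σ.cluster u = b ∧ σ.cluster v = a)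
    (hne : a ≠ b) (hab : σ.level a ≤ σ.level b) (hd : D u v ≤ 2 ^ σ.level a) :
    Invariant D pen m (σ.merge u v a b) := by
  have ha : a ∈ σ.live := by
    rcases huv with ⟨rfl, _⟩ | ⟨_, rfl⟩
    exacts [h.cluster_live u hu, h.cluster_live v hv]
  have hb : b ∈ σ.live := by
    rcases huv with ⟨_, rfl⟩ | ⟨rfl, _⟩
    exacts [h.cluster_live v hv, h.cluster_live u hu]
  have hcl : ∀ p, (σ.merge u v a b).cluster p = if σ.cluster p = a then b else σ.cluster p :=
    fun _ => rfl
  have hat := merge_atom σ u v a b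
  have hmono : ∀ {p q}, σ.Joined p q → (σ.merge u v a b).Joined p q :=
    Joined.mono (Finset.subset_insert _ _)
  have hnew : (σ.merge u v a b).Joined u v :=
    Relation.EqvGen.rel _ _ (Finset.mem_insert_self _ _)
  have hbridge : ∀ p ∈ σ.arrived, ∀ q ∈ σ.arrived, σ.cluster p = a → σ.cluster q = b →
      (σ.merge u v a b).Joined p q := by
    intro p hp q hq hpa hqb
    rcases huv with ⟨hua, hvb⟩ | ⟨hub, hva⟩
    · exact (hmono (h.joined p hp u hu (hpa.trans hua.symm))).trans _ _ _
        (hnew.trans _ _ _ (hmono (h.joined v hv q hq (hvb.trans hqb.symm))))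
    · exact (hmono (h.joined p hp v hv (hpa.trans hva.symm))).trans _ _ _
        ((hnew.symm _ _).trans _ _ _ (hmono (h.joined u hu q hq (hub.trans hqb.symm))))
  exact
  { arrived_lt := h.arrived_lt
    live_lt := fun x hx => h.live_lt x (Finset.mem_of_mem_erase hx)
    edges_lt := by
      intro e he
      rcases Finset.mem_insert.1 he with rfl | he
      · exact ⟨h.arrived_lt u hu, h.arrived_lt v hv⟩
      · exact h.edges_lt e he
    atom_lt := by
      intro e he
      rw [hat]
      split_ifs
      exacts [h.live_lt b hb, h.atom_lt e he]
    charge_arrived := h.charge_arrived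
    cluster_live := by
      intro p hp
      rw [hcl]
      split_ifs with hpa
      · exact Finset.mem_erase.2 ⟨hne.symm, hb⟩
      · exact Finset.mem_erase.2 ⟨hpa, h.cluster_live p hp⟩
    joined := by
      intro p hp q hq hpq
      rw [hcl, hcl] at hpq
      split_ifs at hpq with hpa hqa hqa
      · exact hmono (h.joined p hp q hq (hpa.trans hqa.symm))
      · exact hbridge p hp q hq hpa hpq.symm
      · exact (hbridge q hq p hp hqa hpq).symm _ _
      · exact hmono (h.joined p hp q hq hpq)
    charge_le := fun e he => (h.charge_le e he).trans
      ((extends_merge σ u v hab).level e.1 (h.charge_arrived e he))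
    charge_eq := by
      intro e he heq
      have h1 := h.charge_le e he
      rw [hcl] at heq ⊢
      change e.2 = σ.level _ at heq
      rw [hat]
      by_cases hea : σ.cluster e.1 = a
      · rw [if_pos hea] at heq ⊢
        rw [hea] at h1
        have h2 : e.2 = σ.level a := by omega
        exact if_pos ⟨h2, heq, (h.charge_eq e he (by rw [hea, h2])).trans hea⟩
      · rw [if_neg hea] at heq ⊢
        have h2 := h.charge_eq e he heq
        rw [if_neg fun hc => hea (h2.symm.trans hc.2.2)]
        exact h2
    charge_le_atom := by
      intro e he
      rw [hat]
      split_ifs with hc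
      exacts [hc.2.1.le, h.charge_le_atom e he]
    separated := by
      intro e he f hf hef hne'
      refine h.separated e he f hf hef fun heq => hne' ?_
      rw [hat, hat, hef, heq]
    far := h.far
    amount_nonneg := h.amount_nonneg
    amount_le := h.amount_le
    atomSum_le := by
      intro x j
      refine (h.atomSum_merge_le u v a b x j).trans ?_
      split_ifs with hc
      · obtain ⟨rfl, hja, hjb⟩ := hc
        have h1 := ht a ha
        have h2 := ht x hb
        rw [← hja] at h1
        rw [← hjb] at h2
        linarith
      · rw [add_zero]
        exact h.atomSum_le x j
    paid_lt := h.paid_lt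
    paid_le := h.paid_le
    credit := by
      have h1 : ∑ e ∈ insert (u, v) σ.edges, D e.1 e.2 ≤
          ∑ e ∈ σ.edges, D e.1 e.2 + 2 ^ σ.level a := by
        by_cases hmem : (u, v) ∈ σ.edges
        · rw [Finset.insert_eq_of_mem hmem]
          exact le_add_of_nonneg_right (by positivity)
        · rw [Finset.sum_insert hmem]
          linarith
      have h2 := Finset.add_sum_erase σ.live (fun x => (2 : ℝ) ^ σ.level x) ha
      have h3 : (σ.merge u v a b).openSum ≤ σ.openSum := by
        refine Finset.sum_le_sum_of_subset_of_nonneg ?_ fun e he _ =>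
          h.amount_nonneg e (Finset.mem_filter.1 he).1
        intro e he
        rw [Finset.mem_filter, hat] at he
        rw [Finset.mem_filter]
        split_ifs at he with hc
        · exact ⟨he.1, hc.2.2 ▸ ha, hc.2.2.symm ▸ hc.1⟩
        · exact ⟨he.1, Finset.mem_of_mem_erase he.2.1, he.2.2⟩
      have h4 := h.credit
      change ∑ e ∈ insert (u, v) σ.edges, D e.1 e.2 +
        ∑ x ∈ σ.live.erase a, (2 : ℝ) ^ σ.level x + (σ.merge u v a b).openSum ≤
        allowance D pen m + ∑ e ∈ σ.charges, σ.amount e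
      linarith
    live_reason := fun x hx => h.live_reason x (Finset.mem_of_mem_erase hx)
    charge_reason := h.charge_reason }

/-! ### Charging a terminal -/

/-- Charge the terminal `p` at the level of its cluster. -/
def ClusterState.charge (σ : ClusterState) (p : ℕ × Bool) (x : ℝ) : ClusterState :=
  { σ with
    charges := insert (p, σ.level (σ.cluster p)) σ.charges
    amount := Function.update σ.amount (p, σ.level (σ.cluster p)) x
    atom := Function.update σ.atom (p, σ.level (σ.cluster p)) (σ.cluster p) }

theorem extends_charge (σ : ClusterState) (p : ℕ × Bool) (x : ℝ) :
    σ.Extends (σ.charge p x) :=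
  ⟨subset_rfl, subset_rfl, subset_rfl, fun _ _ => le_rfl⟩

/-- The predicate covers the sums by moat, level and request and the open sum at once. Since the key
is new, no earlier charge is overwritten. -/
theorem sum_charge {σ : ClusterState} {p : ℕ × Bool} (x : ℝ)
    (hp : (p, σ.level (σ.cluster p)) ∉ σ.charges)
    (P : ℕ × Bool → ℤ → ℕ × Bool → Prop) [∀ a b c, Decidable (P a b c)] :
    ∑ e ∈ (σ.charge p x).charges with P e.1 e.2 ((σ.charge p x).atom e),
        (σ.charge p x).amount e =
      ∑ e ∈ σ.charges with P e.1 e.2 (σ.atom e), σ.amount e +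
        if P p (σ.level (σ.cluster p)) (σ.cluster p) then x else 0 := by
  have hat : (σ.charge p x).atom (p, σ.level (σ.cluster p)) = σ.cluster p := by
    simp [ClusterState.charge]
  have ham : (σ.charge p x).amount (p, σ.level (σ.cluster p)) = x := by
    simp [ClusterState.charge]
  rw [Finset.sum_filter, Finset.sum_filter]
  change ∑ e ∈ insert (p, σ.level (σ.cluster p)) σ.charges, _ = _
  rw [Finset.sum_insert hp, add_comm]
  congr 1
  · refine Finset.sum_congr rfl fun e he => ?_
    have hne : e ≠ (p, σ.level (σ.cluster p)) := fun hh => hp (hh ▸ he)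
    have h1 : (σ.charge p x).atom e = σ.atom e := by simp [ClusterState.charge, hne]
    have h2 : (σ.charge p x).amount e = σ.amount e := by simp [ClusterState.charge, hne]
    simp only [h1, h2]
  · simp only [hat, ham]

/-- Separation is the point: an old charge at this level in another moat comes from a terminal of
another cluster, whose level is at least as high, so `Settled` gives the distance. Credit is
preserved because the open sum and the total charge grow by the same amount. -/
theorem Invariant.charge (h : Invariant D pen m σ) (hs : σ.Settled D) {p : ℕ × Bool} {x : ℝ}
    (hp : p ∈ σ.arrived) (hnew : (p, σ.level (σ.cluster p)) ∉ σ.charges)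
    (hx : 0 ≤ x) (hxp : x ≤ pen p.1)
    (hfit : σ.atomSum (σ.cluster p) (σ.level (σ.cluster p)) + x ≤ 2 ^ σ.level (σ.cluster p))
    (hfar : (2 : ℝ) ^ σ.level (σ.cluster p) < D p (partner p)) :
    Invariant D pen m (σ.charge p x) := by
  have hatom : ∀ a j, (σ.charge p x).atomSum a j = σ.atomSum a j +
      if σ.level (σ.cluster p) = j ∧ σ.cluster p = a then x else 0 := fun a j =>
    sum_charge x hnew fun _ k c => k = j ∧ c = a
  have hlevel : ∀ j, σ.levelSum j ≤ (σ.charge p x).levelSum j := fun j => by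
    have := sum_charge x hnew fun _ k _ => k = j
    unfold ClusterState.levelSum
    rw [this]
    exact le_add_of_nonneg_right (by split_ifs <;> simp [hx])
  have hcases : ∀ e ∈ (σ.charge p x).charges,
      (e = (p, σ.level (σ.cluster p)) ∧ (σ.charge p x).atom e = σ.cluster p ∧
        (σ.charge p x).amount e = x) ∨
      (e ∈ σ.charges ∧ (σ.charge p x).atom e = σ.atom e ∧
        (σ.charge p x).amount e = σ.amount e) := by
    intro e he
    by_cases hne : e = (p, σ.level (σ.cluster p))
    · left; subst hne; simp [ClusterState.charge]
    · right
      rcases Finset.mem_insert.1 he with h1 | h1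
      · exact absurd h1 hne
      · simp [ClusterState.charge, hne, h1]
  exact
  { arrived_lt := h.arrived_lt
    live_lt := h.live_lt
    edges_lt := h.edges_lt
    atom_lt := by
      intro e he
      rcases hcases e he with ⟨_, h2, _⟩ | ⟨h1, h2, _⟩
      · rw [h2]; exact h.live_lt _ (h.cluster_live p hp)
      · rw [h2]; exact h.atom_lt e h1
    charge_arrived := by
      intro e he
      rcases hcases e he with ⟨rfl, _, _⟩ | ⟨h1, _, _⟩
      exacts [hp, h.charge_arrived e h1]
    cluster_live := h.cluster_live
    joined := h.joined
    charge_le := by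
      intro e he
      rcases hcases e he with ⟨rfl, _, _⟩ | ⟨h1, _, _⟩
      exacts [le_rfl, h.charge_le e h1]
    charge_eq := by
      intro e he heq
      rcases hcases e he with ⟨rfl, h2, _⟩ | ⟨h1, h2, _⟩
      · exact h2
      · rw [h2]; exact h.charge_eq e h1 heq
    charge_le_atom := by
      intro e he
      rcases hcases e he with ⟨rfl, h2, _⟩ | ⟨h1, h2, _⟩
      · rw [h2]; exact le_rfl
      · rw [h2]; exact h.charge_le_atom e h1
    separated := by
      have key : ∀ f ∈ σ.charges, f.2 = σ.level (σ.cluster p) → σ.atom f ≠ σ.cluster p →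
          (2 : ℝ) ^ σ.level (σ.cluster p) < D p f.1 ∧
          (2 : ℝ) ^ σ.level (σ.cluster p) < D f.1 p := by
        intro f hf hfl hfa
        have h1 := h.charge_le f hf
        have h2 : σ.cluster f.1 ≠ σ.cluster p := fun h3 =>
          hfa ((h.charge_eq f hf (by rw [h3, hfl])).trans h3)
        have h3 := hs p hp f.1 (h.charge_arrived f hf) h2.symm
        have h4 := hs f.1 (h.charge_arrived f hf) p hp h2
        rw [min_eq_left (by omega)] at h3
        rw [min_eq_right (by omega)] at h4
        exact ⟨h3, h4⟩
      intro e he f hf hef hne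
      rcases hcases e he with ⟨rfl, h2, _⟩ | ⟨h1, h2, _⟩ <;>
        rcases hcases f hf with ⟨rfl, k2, _⟩ | ⟨k1, k2, _⟩
      · exact absurd rfl hne
      · rw [h2, k2] at hne
        exact (key f k1 hef.symm hne.symm).1
      · rw [h2, k2] at hne
        have := (key e h1 hef hne).2
        rwa [hef]
      · rw [h2, k2] at hne
        exact h.separated e h1 f k1 hef hne
    far := by
      intro e he
      rcases hcases e he with ⟨rfl, _, _⟩ | ⟨h1, _, _⟩
      exacts [hfar, h.far e h1]
    amount_nonneg := by
      intro e he
      rcases hcases e he with ⟨_, _, h3⟩ | ⟨h1, _, h3⟩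
      · rw [h3]; exact hx
      · rw [h3]; exact h.amount_nonneg e h1
    amount_le := by
      intro e he
      rcases hcases e he with ⟨rfl, _, h3⟩ | ⟨h1, _, h3⟩
      · rw [h3]; exact hxp
      · rw [h3]; exact h.amount_le e h1
    atomSum_le := by
      intro a j
      rw [hatom]
      split_ifs with hc
      · obtain ⟨rfl, rfl⟩ := hc
        have : (0 : ℝ) < 2 ^ σ.level (σ.cluster p) := by positivity
        linarith
      · rw [add_zero]; exact h.atomSum_le a j
    paid_lt := h.paid_lt
    paid_le := by
      intro i hi
      refine (h.paid_le i hi).trans ?_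
      have := sum_charge x hnew fun q _ _ => q.1 = i
      unfold ClusterState.requestSum
      rw [this]
      exact le_add_of_nonneg_right (by split_ifs <;> simp [hx])
    credit := by
      have h1 := sum_charge x hnew fun _ k c => c ∈ σ.live ∧ k = σ.level c
      rw [if_pos ⟨h.cluster_live p hp, rfl⟩] at h1
      have h2 := sum_charge x hnew fun _ _ _ => True
      simp only [Finset.filter_true, if_true] at h2
      have h3 := h.credit
      change ∑ e ∈ σ.edges, D e.1 e.2 + ∑ a ∈ σ.live, (2 : ℝ) ^ σ.level a +
        (σ.charge p x).openSum ≤ _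
      have h4 : (σ.charge p x).openSum = σ.openSum + x := h1
      linarith
    live_reason := fun a ha => (h.live_reason a ha).imp_right fun h1 => h1.trans (hlevel _)
    charge_reason := by
      intro e he
      rcases hcases e he with ⟨rfl, _, _⟩ | ⟨h1, _, _⟩
      · exact (h.live_reason _ (h.cluster_live p hp)).imp_right fun h1 => h1.trans (hlevel _)
      · exact (h.charge_reason e h1).imp_right fun h1 => h1.trans (hlevel _) }

end Operations

section Steps

variable {D : ℕ × Bool → ℕ × Bool → ℝ} {pen : ℕ → ℝ} {m n : ℕ} {σ τ : ClusterState}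

theorem Invariant.atomSum_eq_zero (h : Invariant D pen m σ) {a : ℕ × Bool} (ha : m ≤ a.1)
    (j : ℤ) : σ.atomSum a j = 0 := by
  refine Finset.sum_eq_zero fun e he => ?_
  rw [Finset.mem_filter] at he
  have := h.atom_lt e he.1
  rw [he.2.2] at this
  omega

/-! ### Paying a penalty -/

/-- Pay the penalty of request `n`. -/
def ClusterState.pay (σ : ClusterState) (n : ℕ) : ClusterState :=
  { σ with paid := insert n σ.paid }

theorem extends_pay (σ : ClusterState) (n : ℕ) : σ.Extends (σ.pay n) :=
  ⟨subset_rfl, Finset.subset_insert _ _, subset_rfl, fun _ _ => le_rfl⟩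

theorem Invariant.pay (h : Invariant D pen m σ) (hnm : n < m)
    (hn : pen n ≤ σ.requestSum n) : Invariant D pen m (σ.pay n) :=
  { h with
    paid_lt := by
      intro i hi
      rcases Finset.mem_insert.1 hi with rfl | hi
      exacts [hnm, h.paid_lt i hi]
    paid_le := by
      intro i hi
      rcases Finset.mem_insert.1 hi with rfl | hi
      exacts [hn, h.paid_le i hi] }

theorem Invariant.requestSum_nonneg (h : Invariant D pen m σ) (i : ℕ) : 0 ≤ σ.requestSum i :=
  Finset.sum_nonneg fun e he => h.amount_nonneg e (Finset.mem_filter.1 he).1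

/-! ### Arrival of a request -/

theorem threshold_nonneg (hpen : ∀ i, 0 ≤ pen i) (hD : ∀ p q, 0 ≤ D p q) (i : ℕ) :
    0 ≤ threshold D pen i := le_min (hpen i) (hD _ _)

theorem Invariant.succ (h : Invariant D pen n σ) (hn : 0 ≤ threshold D pen n) :
    Invariant D pen (n + 1) σ :=
  { h with
    arrived_lt := fun p hp => (h.arrived_lt p hp).trans n.lt_succ_self
    live_lt := fun p hp => (h.live_lt p hp).trans n.lt_succ_self
    edges_lt := fun e he => ⟨(h.edges_lt e he).1.trans n.lt_succ_self,
      (h.edges_lt e he).2.trans n.lt_succ_self⟩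
    atom_lt := fun p hp => (h.atom_lt p hp).trans n.lt_succ_self
    paid_lt := fun p hp => (h.paid_lt p hp).trans n.lt_succ_self
    credit := by
      refine h.credit.trans (add_le_add_left ?_ _)
      unfold allowance
      rw [Finset.sum_range_succ]
      exact le_add_of_nonneg_right (by positivity)
    live_reason := fun a ha => (h.live_reason a ha).imp_left
      fun ⟨i, hi, h1⟩ => ⟨i, hi.trans n.lt_succ_self, h1⟩
    charge_reason := fun a ha => (h.charge_reason a ha).imp_left
      fun ⟨i, hi, h1⟩ => ⟨i, hi.trans n.lt_succ_self, h1⟩ }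

/-- The invariant looks only at the first `m` requests, so it passes between the observation of a
prefix and that of the whole sequence. -/
theorem Invariant.congr {D' : ℕ × Bool → ℕ × Bool → ℝ} {pen' : ℕ → ℝ}
    (h : Invariant D pen m σ) (hD : ∀ p q, p.1 < m → q.1 < m → D p q = D' p q)
    (hpen : ∀ i < m, pen i = pen' i) : Invariant D' pen' m σ := by
  have hth : ∀ i < m, threshold D pen i = threshold D' pen' i := fun i hi => by
    unfold threshold
    rw [hpen i hi, hD _ _ hi hi]
  have hlt : ∀ e ∈ σ.charges, e.1.1 < m := fun e he => h.arrived_lt _ (h.charge_arrived e he)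
  exact
  { h with
    separated := fun e he f hf => by
      rw [← hD _ _ (hlt e he) (hlt f hf)]
      exact h.separated e he f hf
    far := fun e he => by
      rw [← hD _ _ (hlt e he) (by exact hlt e he)]
      exact h.far e he
    amount_le := fun e he => by
      rw [← hpen _ (hlt e he)]
      exact h.amount_le e he
    paid_le := fun i hi => by
      rw [← hpen i (h.paid_lt i hi)]
      exact h.paid_le i hi
    credit := by
      have h1 : allowance D' pen' m = allowance D pen m :=
        Finset.sum_congr rfl fun i hi => by rw [hth i (Finset.mem_range.1 hi)]
      have h2 : ∑ e ∈ σ.edges, D' e.1 e.2 = ∑ e ∈ σ.edges, D e.1 e.2 :=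
        Finset.sum_congr rfl fun e he =>
          (hD _ _ (h.edges_lt e he).1 (h.edges_lt e he).2).symm
      rw [h1, h2]
      exact h.credit
    live_reason := fun a ha => (h.live_reason a ha).imp_left
      fun ⟨i, hi, h1⟩ => ⟨i, hi, hth i hi ▸ h1⟩
    charge_reason := fun a ha => (h.charge_reason a ha).imp_left
      fun ⟨i, hi, h1⟩ => ⟨i, hi, hth i hi ▸ h1⟩ }

/-- Add the terminals of request `n` as clusters of level `b`. -/
def ClusterState.arrive (σ : ClusterState) (n : ℕ) (b : ℤ) : ClusterState :=
  { σ with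
    arrived := insert (n, false) (insert (n, true) σ.arrived)
    live := insert (n, false) (insert (n, true) σ.live)
    cluster := fun p => if p.1 = n then p else σ.cluster p
    level := fun p => if p.1 = n then b else σ.level p }

/-- The two initial credits come from the allowance. The factor (1/2)^(n+1) keeps the sum of all
allowances within a constant times the largest threshold, however many requests arrive. -/
theorem Invariant.arrive (h : Invariant D pen n σ) {b : ℤ}
    (hb : (2 : ℝ) ^ b ≤ threshold D pen n * (1 / 2) ^ (n + 1)) :
    Invariant D pen (n + 1) (σ.arrive n b) := by
  have hcl : ∀ p ∈ σ.arrived, (σ.arrive n b).cluster p = σ.cluster p := fun p hp =>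
    if_neg (h.arrived_lt p hp).ne
  have hlev : ∀ a : ℕ × Bool, a.1 < n → (σ.arrive n b).level a = σ.level a := fun a ha =>
    if_neg ha.ne
  have hclev : ∀ p ∈ σ.arrived,
      (σ.arrive n b).level ((σ.arrive n b).cluster p) = σ.level (σ.cluster p) := fun p hp => by
    rw [hcl p hp, hlev _ (h.live_lt _ (h.cluster_live p hp))]
  have hclnew : ∀ p : ℕ × Bool, p.1 = n → (σ.arrive n b).cluster p = p := fun p hp =>
    if_pos hp
  have hlevnew : ∀ p : ℕ × Bool, p.1 = n → (σ.arrive n b).level p = b := fun p hp =>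
    if_pos hp
  have hmem : ∀ (S : Finset (ℕ × Bool)) (p : ℕ × Bool),
      p ∈ insert (n, false) (insert (n, true) S) ↔ p.1 = n ∨ p ∈ S := by
    rintro S ⟨i, c⟩
    cases c <;> simp
  have hpow : (0 : ℝ) < 2 ^ b := by positivity
  have hth : 0 < threshold D pen n := by
    by_contra hc
    have : threshold D pen n * (1 / 2) ^ (n + 1) ≤ 0 :=
      mul_nonpos_of_nonpos_of_nonneg (not_lt.1 hc) (by positivity)
    linarith
  have hbth : (2 : ℝ) ^ b ≤ threshold D pen n :=
    hb.trans (mul_le_of_le_one_right hth.le (pow_le_one₀ (by norm_num) (by norm_num)))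
  have hs := h.succ hth.le
  exact
  { hs with
    arrived_lt := by
      intro p hp
      rcases (hmem _ _).1 hp with hp | hp
      exacts [hp ▸ n.lt_succ_self, hs.arrived_lt p hp]
    live_lt := by
      intro p hp
      rcases (hmem _ _).1 hp with hp | hp
      exacts [hp ▸ n.lt_succ_self, hs.live_lt p hp]
    charge_arrived := fun e he => (hmem _ _).2 (Or.inr (h.charge_arrived e he))
    cluster_live := by
      intro p hp
      refine (hmem _ _).2 ?_
      rcases (hmem _ _).1 hp with hp | hp
      · exact Or.inl (by rw [hclnew p hp, hp])
      · exact Or.inr (by rw [hcl p hp]; exact h.cluster_live p hp)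
    joined := by
      intro p hp q hq hpq
      rcases (hmem _ _).1 hp with hp | hp <;> rcases (hmem _ _).1 hq with hq | hq
      · rw [hclnew p hp, hclnew q hq] at hpq
        rw [hpq]
        exact Relation.EqvGen.refl _
      · rw [hclnew p hp, hcl q hq] at hpq
        have := h.live_lt _ (h.cluster_live q hq)
        rw [← hpq] at this
        omega
      · rw [hcl p hp, hclnew q hq] at hpq
        have := h.live_lt _ (h.cluster_live p hp)
        rw [hpq] at this
        omega
      · rw [hcl p hp, hcl q hq] at hpq
        exact h.joined p hp q hq hpq
    charge_le := fun e he => by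
      rw [hclev _ (h.charge_arrived e he)]
      exact h.charge_le e he
    charge_eq := fun e he heq => by
      rw [hclev _ (h.charge_arrived e he)] at heq
      rw [hcl _ (h.charge_arrived e he)]
      exact h.charge_eq e he heq
    charge_le_atom := fun e he => by
      change e.2 ≤ (σ.arrive n b).level (σ.atom e)
      rw [hlev _ (h.atom_lt e he)]
      exact h.charge_le_atom e he
    credit := by
      have h1 : ∑ a ∈ insert (n, false) (insert (n, true) σ.live),
          (2 : ℝ) ^ (σ.arrive n b).level a = 2 ^ b + (2 ^ b + ∑ a ∈ σ.live, 2 ^ σ.level a) := by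
        rw [Finset.sum_insert, Finset.sum_insert, hlevnew _ rfl, hlevnew _ rfl]
        · congr 2
          exact Finset.sum_congr rfl fun a ha => by rw [hlev a (h.live_lt a ha)]
        · exact fun hc => (h.live_lt _ hc).ne rfl
        · rw [Finset.mem_insert]
          rintro (hc | hc)
          · simp at hc
          · exact (h.live_lt _ hc).ne rfl
      have h2 : (σ.arrive n b).openSum = σ.openSum := by
        change ∑ e ∈ σ.charges with σ.atom e ∈ insert (n, false) (insert (n, true) σ.live) ∧
          e.2 = (σ.arrive n b).level (σ.atom e), σ.amount e = _
        refine Finset.sum_congr (Finset.filter_congr fun e he => ?_) fun _ _ => rfl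
        rw [hlev _ (h.atom_lt e he), hmem, or_iff_right (h.atom_lt e he).ne]
      have h3 := h.credit
      have h4 : allowance D pen (n + 1) =
          allowance D pen n + 2 * (threshold D pen n * (1 / 2) ^ (n + 1)) :=
        Finset.sum_range_succ _ _
      change ∑ e ∈ σ.edges, D e.1 e.2 + ∑ a ∈ insert (n, false) (insert (n, true) σ.live),
          (2 : ℝ) ^ (σ.arrive n b).level a + (σ.arrive n b).openSum ≤
        allowance D pen (n + 1) + ∑ e ∈ σ.charges, σ.amount e
      rw [h1, h2, h4]
      linarith
    live_reason := by
      intro a ha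
      rcases (hmem _ _).1 ha with ha | ha
      · rw [hlevnew a ha]
        exact Or.inl ⟨n, n.lt_succ_self, hbth⟩
      · rw [hlev a (h.live_lt a ha)]
        exact hs.live_reason a ha }

theorem Invariant.extends_arrive (h : Invariant D pen n σ) (b : ℤ) :
    σ.Extends (σ.arrive n b) := by
  refine ⟨subset_rfl, subset_rfl, fun p hp => Finset.mem_insert_of_mem
    (Finset.mem_insert_of_mem hp), fun p hp => ?_⟩
  simp [ClusterState.arrive, (h.arrived_lt p hp).ne,
    (h.live_lt _ (h.cluster_live p hp)).ne]

theorem Invariant.tight_arrive (h : Invariant D pen n σ) (ht : σ.Tight) (b : ℤ) :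
    (σ.arrive n b).Tight := by
  intro a ha
  by_cases han : a.1 = n
  · change σ.atomSum a _ ≤ _
    rw [h.atomSum_eq_zero han.ge]
    positivity
  · have ha' : a ∈ σ.live := by
      rcases Finset.mem_insert.1 ha with rfl | ha
      · exact absurd rfl han
      rcases Finset.mem_insert.1 ha with rfl | ha
      · exact absurd rfl han
      · exact ha
    have hl : (σ.arrive n b).level a = σ.level a := if_neg han
    rw [hl]
    exact ht a ha'

/-! ### Serving a request -/

theorem ClusterState.Fresh.of_extends (hf : σ.Fresh n) (h : Invariant D pen m σ)
    (he : σ.Extends τ) (hc : τ.charges = σ.charges) : τ.Fresh n := by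
  intro e hmem hn
  rw [hc] at hmem
  exact (hf e hmem hn).trans_le (he.level _ (h.charge_arrived e hmem))

/-- A merge can overfill the moat of the surviving cluster. Being full, that moat pays for raising
the level at once, and the new moat is empty, so tightness returns. -/
theorem Invariant.exists_merge (h : Invariant D pen m σ) (ht : σ.Tight) (hf : σ.Fresh n)
    {u v a b : ℕ × Bool} (hu : u ∈ σ.arrived) (hv : v ∈ σ.arrived)
    (huv : σ.cluster u = a ∧ σ.cluster v = b ∨ σ.cluster u = b ∧ σ.cluster v = a)
    (hne : a ≠ b) (hab : σ.level a ≤ σ.level b) (hd : D u v ≤ 2 ^ σ.level a) :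
    ∃ τ, Invariant D pen m τ ∧ τ.Tight ∧ τ.Fresh n ∧ σ.Extends τ ∧
      τ.live.card < σ.live.card := by
  have ha : a ∈ σ.live := by
    rcases huv with ⟨rfl, _⟩ | ⟨_, rfl⟩
    exacts [h.cluster_live u hu, h.cluster_live v hv]
  have hb : b ∈ σ.live := by
    rcases huv with ⟨_, rfl⟩ | ⟨rfl, _⟩
    exacts [h.cluster_live v hv, h.cluster_live u hu]
  have hi := h.merge ht hu hv huv hne hab hd
  have he := extends_merge σ u v hab
  have hcard : (σ.merge u v a b).live.card < σ.live.card := Finset.card_erase_lt_of_mem ha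
  have hother : ∀ x ∈ (σ.merge u v a b).live, x ≠ b →
      (σ.merge u v a b).atomSum x (σ.level x) ≤ 2 ^ σ.level x := by
    intro x hx hxb
    refine (h.atomSum_merge_le u v a b x _).trans ?_
    rw [if_neg fun hc => hxb hc.1, add_zero]
    exact ht x (Finset.mem_of_mem_erase hx)
  by_cases hfull : (σ.merge u v a b).atomSum b (σ.level b) ≤ 2 ^ σ.level b
  · refine ⟨_, hi, fun x hx => ?_, hf.of_extends h he rfl, he, hcard⟩
    by_cases hxb : x = b
    · subst hxb; exact hfull
    · exact hother x hx hxb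
  · have he' := he.trans (extends_levelUp (σ.merge u v a b) b)
    refine ⟨(σ.merge u v a b).levelUp b,
      hi.levelUp (Finset.mem_erase.2 ⟨hne.symm, hb⟩) (not_le.1 hfull).le, fun x hx => ?_,
      hf.of_extends h he' rfl, he', hcard⟩
    by_cases hxb : x = b
    · subst hxb
      rw [hi.atomSum_levelUp]
      positivity
    · have hl : ((σ.merge u v a b).levelUp b).level x = σ.level x := by
        simp [ClusterState.levelUp, ClusterState.merge, hxb]
      rw [hl]
      exact hother x hx hxb

theorem Invariant.exists_settled (h : Invariant D pen m σ) (ht : σ.Tight) (hf : σ.Fresh n) :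
    ∃ τ, Invariant D pen m τ ∧ τ.Tight ∧ τ.Fresh n ∧ σ.Extends τ ∧ τ.Settled D := by
  induction hk : σ.live.card using Nat.strong_induction_on generalizing σ with
  | _ k ih =>
    by_cases hs : σ.Settled D
    · exact ⟨σ, h, ht, hf, Extends.refl σ, hs⟩
    · have hmerge : ∃ τ, Invariant D pen m τ ∧ τ.Tight ∧ τ.Fresh n ∧ σ.Extends τ ∧
          τ.live.card < σ.live.card := by
        unfold ClusterState.Settled at hs
        push Not at hs
        obtain ⟨p, hp, q, hq, hne, hd⟩ := hs
        rcases le_total (σ.level (σ.cluster p)) (σ.level (σ.cluster q)) with hle | hle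
        · rw [min_eq_left hle] at hd
          exact h.exists_merge ht hf hp hq (Or.inl ⟨rfl, rfl⟩) hne hle hd
        · rw [min_eq_right hle] at hd
          exact h.exists_merge ht hf hp hq (Or.inr ⟨rfl, rfl⟩) hne.symm hle hd
      obtain ⟨τ, h1, h2, h3, h4, h5⟩ := hmerge
      obtain ⟨υ, k1, k2, k3, k4, k5⟩ := ih _ (hk ▸ h5) h1 h2 h3 rfl
      exact ⟨υ, k1, k2, k3, h4.trans k4, k5⟩

/-- Settle, charge, rise, repeat. Levels of terminals never drop and the charged one rises while
below `K`, so the total gap to `K` is a termination measure. -/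
theorem Invariant.exists_served (h : Invariant D pen m σ) (ht : σ.Tight) (hf : σ.Fresh n)
    (hnm : n < m) (hpen : 0 ≤ pen n) (hmem : ∀ c, (n, c) ∈ σ.arrived) {K : ℤ}
    (hK : ∀ c, D (n, c) (n, !c) ≤ 2 ^ K) :
    ∃ τ, Invariant D pen m τ ∧ τ.Tight ∧ σ.Extends τ ∧
      (n ∈ τ.paid ∨ τ.Joined (n, false) (n, true)) := by
  induction hk : ∑ c, (K - σ.level (σ.cluster (n, c))).toNat using Nat.strong_induction_on
    generalizing σ with
  | _ k ih =>
    obtain ⟨τ, hi, ht', hf', he, hs⟩ := h.exists_settled ht hf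
    have hmem' : ∀ c, (n, c) ∈ τ.arrived := fun c => he.arrived (hmem c)
    by_cases hcl : τ.cluster (n, false) = τ.cluster (n, true)
    · exact ⟨τ, hi, ht', he, Or.inr (hi.joined _ (hmem' _) _ (hmem' _) hcl)⟩
    have hcl' : ∀ c, τ.cluster (n, c) ≠ τ.cluster (n, !c) := by
      intro c
      cases c
      exacts [hcl, Ne.symm hcl]
    -- Charging the terminal of lower level makes the minimum in `Settled` equal to its own level,
    -- which gives the `far` condition.
    obtain ⟨c, hc⟩ : ∃ c, τ.level (τ.cluster (n, c)) ≤ τ.level (τ.cluster (n, !c)) := by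
      rcases le_total (τ.level (τ.cluster (n, false))) (τ.level (τ.cluster (n, true))) with h1 | h1
      exacts [⟨false, h1⟩, ⟨true, h1⟩]
    have hfar := hs _ (hmem' c) _ (hmem' (!c)) (hcl' c)
    rw [min_eq_left hc] at hfar
    have hlt : τ.level (τ.cluster (n, c)) < K :=
      (zpow_lt_zpow_iff_right₀ (by norm_num : (1 : ℝ) < 2)).1 (hfar.trans_le (hK c))
    have hnew : ((n, c), τ.level (τ.cluster (n, c))) ∉ τ.charges := fun hc =>
      (hf' _ hc rfl).false
    have hlive := hi.cluster_live _ (hmem' c)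
    have hatom : ∀ x a j, (τ.charge (n, c) x).atomSum a j = τ.atomSum a j +
        if τ.level (τ.cluster (n, c)) = j ∧ τ.cluster (n, c) = a then x else 0 := fun x a j =>
      sum_charge x hnew fun _ k c => k = j ∧ c = a
    -- The full penalty is charged, not what remains after earlier charges of this request, so this
    -- last charge alone covers the payment.
    by_cases hfit : τ.atomSum (τ.cluster (n, c)) (τ.level (τ.cluster (n, c))) + pen n ≤
        2 ^ τ.level (τ.cluster (n, c))
    · have hi' := hi.charge hs (hmem' c) hnew hpen le_rfl hfit hfar
      have hreq : pen n ≤ (τ.charge (n, c) (pen n)).requestSum n := by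
        have h1 := sum_charge (pen n) hnew fun q _ _ => q.1 = n
        rw [if_pos rfl] at h1
        have h2 := hi.requestSum_nonneg n
        unfold ClusterState.requestSum at h2 ⊢
        linarith
      refine ⟨_, hi'.pay hnm hreq, fun a ha => ?_,
        (he.trans (extends_charge τ _ _)).trans (extends_pay _ n),
        Or.inl (Finset.mem_insert_self _ _)⟩
      change (τ.charge (n, c) (pen n)).atomSum a (τ.level a) ≤ 2 ^ τ.level a
      rw [hatom]
      split_ifs with h1
      · obtain ⟨-, rfl⟩ := h1
        exact hfit
      · rw [add_zero]
        exact ht' a ha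
    -- The amount `x` fills the moat exactly. It is less than the penalty, since the penalty does
    -- not fit.
    · obtain ⟨x, hx⟩ : ∃ x, τ.atomSum (τ.cluster (n, c)) (τ.level (τ.cluster (n, c))) + x =
          2 ^ τ.level (τ.cluster (n, c)) := ⟨_, add_sub_cancel _ _⟩
      have hx0 : 0 ≤ x := by linarith [ht' _ hlive]
      have hi' := hi.charge hs (hmem' c) hnew hx0 (by dsimp only; linarith) hx.le hfar
      have hsum : (τ.charge (n, c) x).atomSum (τ.cluster (n, c)) (τ.level (τ.cluster (n, c))) =
          2 ^ τ.level (τ.cluster (n, c)) := by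
        rw [hatom, if_pos ⟨rfl, rfl⟩, hx]
      have hi'' := hi'.levelUp (a := τ.cluster (n, c)) hlive hsum.ge
      have he' : τ.Extends ((τ.charge (n, c) x).levelUp (τ.cluster (n, c))) :=
        (extends_charge τ _ _).trans (extends_levelUp _ _)
      have hup : ((τ.charge (n, c) x).levelUp (τ.cluster (n, c))).level (τ.cluster (n, c)) =
          τ.level (τ.cluster (n, c)) + 1 := Function.update_self ..
      obtain ⟨υ, k1, k2, k3, k4⟩ := ih (∑ d, (K -
          ((τ.charge (n, c) x).levelUp (τ.cluster (n, c))).level (τ.cluster (n, d))).toNat)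
        (by
          rw [← hk]
          refine Finset.sum_lt_sum (fun d _ => ?_) ⟨c, Finset.mem_univ c, ?_⟩
          · have := (he.trans he').level _ (hmem d)
            refine Int.toNat_le_toNat ?_
            change σ.level (σ.cluster (n, d)) ≤ ((τ.charge (n, c) x).levelUp
              (τ.cluster (n, c))).level (τ.cluster (n, d)) at this
            omega
          · have := he.level _ (hmem c)
            rw [hup]
            omega)
        hi''
        (by
          intro a ha
          by_cases hac : a = τ.cluster (n, c)
          · subst hac
            rw [hi'.atomSum_levelUp]
            positivity
          · have hl : ((τ.charge (n, c) x).levelUp (τ.cluster (n, c))).level a = τ.level a :=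
              Function.update_of_ne hac ..
            rw [hl]
            change (τ.charge (n, c) x).atomSum a (τ.level a) ≤ _
            rw [hatom, if_neg fun h1 => hac h1.2.symm, add_zero]
            exact ht' a ha)
        (by
          intro e hemem hen
          rcases Finset.mem_insert.1 hemem with rfl | hold
          · change _ < ((τ.charge (n, c) x).levelUp (τ.cluster (n, c))).level (τ.cluster (n, c))
            rw [hup]
            exact lt_add_one _
          · exact (hf' e hold hen).trans_le (he'.level _ (hi.charge_arrived e hold)))
        hmem' rfl
      exact ⟨υ, k1, k2, (he.trans he').trans k3, k4⟩

/-- What is guaranteed about the step of request `n`, from state `σ` to state `τ`. -/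
structure ValidStep (D : ℕ × Bool → ℕ × Bool → ℝ) (pen : ℕ → ℝ) (n : ℕ)
    (σ τ : ClusterState) : Prop where
  invariant : Invariant D pen (n + 1) τ
  tight : τ.Tight
  ext : σ.Extends τ
  served : D (n, false) (n, true) = 0 ∨ n ∈ τ.paid ∨ τ.Joined (n, false) (n, true)

theorem Invariant.exists_validStep (h : Invariant D pen n σ) (ht : σ.Tight)
    (hpen : ∀ i, 0 ≤ pen i) (hD : ∀ p q, 0 ≤ D p q) : ∃ τ, ValidStep D pen n σ τ := by
  have hs := h.succ (threshold_nonneg hpen hD n)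
  by_cases hd : D (n, false) (n, true) = 0
  -- The terminals coincide, and they never enter the clustering. This case and that of zero penalty
  -- are separate because a zero threshold leaves no room for an initial level.
  · exact ⟨σ, hs, ht, Extends.refl σ, Or.inl hd⟩
  by_cases hp : pen n = 0
  · exact ⟨σ.pay n, hs.pay n.lt_succ_self (hp ▸ h.requestSum_nonneg n), ht, extends_pay σ n,
      Or.inr (Or.inl (Finset.mem_insert_self _ _))⟩
  have hth : 0 < threshold D pen n :=
    lt_min ((hpen n).lt_of_ne' hp) ((hD _ _).lt_of_ne' hd)
  obtain ⟨b, hb, -⟩ := exists_mem_Ico_zpow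
    (x := threshold D pen n * (1 / 2) ^ (n + 1)) (y := 2) (by positivity) one_lt_two
  -- Symmetry of `D` is not assumed here, so both directions are bounded.
  obtain ⟨K, hK⟩ := pow_unbounded_of_one_lt
    (max (D (n, false) (n, true)) (D (n, true) (n, false))) (one_lt_two (α := ℝ))
  obtain ⟨τ, h1, h2, h3, h4⟩ := (h.arrive hb).exists_served (n := n) (K := K)
    (h.tight_arrive ht b)
    (fun e he hen => absurd hen (h.arrived_lt _ (h.charge_arrived e he)).ne)
    n.lt_succ_self (hpen n)
    (fun c => by cases c <;> simp [ClusterState.arrive])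
    (fun c => by
      rw [zpow_natCast]
      cases c
      · exact (le_max_left _ _).trans hK.le
      · exact (le_max_right _ _).trans hK.le)
  exact ⟨τ, h1, h2, (h.extends_arrive b).trans h3, Or.inr h4⟩

end Steps

/-! ### The algorithm -/

/-- The state before the first request. -/
def ClusterState.initial : ClusterState where
  edges := ∅
  paid := ∅
  arrived := ∅
  live := ∅
  cluster := id
  level := 0
  charges := ∅
  amount := 0
  atom := Prod.fst

theorem Invariant.initial (D : ℕ × Bool → ℕ × Bool → ℝ) (pen : ℕ → ℝ) :
    Invariant D pen 0 ClusterState.initial := by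
  constructor <;> simp [ClusterState.initial, allowance, ClusterState.openSum,
    ClusterState.atomSum]
  exact fun j => by positivity

/-- The distances of an observation, extended by zero. -/
def Observation.dist {n : ℕ} (o : Observation n) (p q : ℕ × Bool) : ℝ :=
  if h : p.1 < n ∧ q.1 < n then o.distance (⟨p.1, h.1⟩, p.2) (⟨q.1, h.2⟩, q.2) else 0

/-- The penalties of an observation, extended by zero. -/
def Observation.pen {n : ℕ} (o : Observation n) (i : ℕ) : ℝ :=
  if h : i < n then o.penalty ⟨i, h⟩ else 0

/-- What was revealed before the last request. -/
def Observation.init {n : ℕ} (o : Observation (n + 1)) : Observation n where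
  distance p q := o.distance (p.1.castSucc, p.2) (q.1.castSucc, q.2)
  penalty i := o.penalty i.castSucc

open Classical in
/-- The states of the algorithm: every request is served by some valid step. -/
def run : (n : ℕ) → Observation n → ClusterState
  | 0, _ => ClusterState.initial
  | n + 1, o =>
    -- The choice depends on the observation only, which makes the algorithm online. For
    -- observations of metric instances the second branch does not occur.
    if h : ∃ τ, ValidStep o.dist o.pen n (run n o.init) τ then h.choose else run n o.init

/-- The position of a terminal among the terminals of the first `n + 1` requests. -/
def toFin (n : ℕ) (p : ℕ × Bool) : Fin (n + 1) × Bool := (Fin.ofNat (n + 1) p.1, p.2)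

open Classical in
/-- The online algorithm that maintains the states `run`. -/
def clusterAlgorithm : OnlineAlgorithm := fun n o =>
  -- Earlier edges are bought again, at no cost since the subgraph is a union of sets. The reduction
  -- in `toFin` is harmless because all edges have indices at most `n`.
  { buy := (run (n + 1) o).edges.image fun e => s(toFin n e.1, toFin n e.2)
    pay := decide (n ∈ (run (n + 1) o).paid) }

open Classical in
/-- The location of a terminal, given by its number. -/
def place {V : Type*} (I : Instance V) (v : V) (p : ℕ × Bool) : V :=
  if h : p.1 < I.len then I.terminal (⟨p.1, h⟩, p.2) else v

theorem place_of_lt {V : Type*} (I : Instance V) (v : V) {p : ℕ × Bool} (hp : p.1 < I.len) :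
    place I v p = I.terminal (⟨p.1, hp⟩, p.2) := dif_pos hp

open Classical in
theorem Joined.connects {V : Type*} {σ : ClusterState} {p q : ℕ × Bool} (h : σ.Joined p q)
    (f : ℕ × Bool → V) : Connects (σ.edges.image fun e => s(f e.1, f e.2)) (f p) (f q) := by
  unfold Connects
  induction h with
  | rel u w huw =>
    -- Terminals with different numbers may share a location; the edge is then a loop, which the
    -- graph ignores.
    by_cases hne : f u = f w
    · rw [hne]
    · refine SimpleGraph.Adj.reachable ?_
      rw [SimpleGraph.fromEdgeSet_adj]
      exact ⟨Finset.mem_coe.2 (Finset.mem_image.2 ⟨(u, w), huw, rfl⟩), hne⟩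
  | refl u => exact SimpleGraph.Reachable.refl _
  | symm u w _ ih => exact ih.symm
  | trans u w x _ _ ih ih' => exact ih.trans ih'

/-! ### The run on an instance: feasibility and cost in terms of charges -/

section Run

variable {V : Type*} [MetricSpace V] (I : Instance V)

theorem observe_dist_nonneg (p q : ℕ × Bool) : 0 ≤ I.observe.dist p q := by
  unfold Observation.dist
  split_ifs
  exacts [dist_nonneg, le_rfl]

theorem observe_pen_nonneg (i : ℕ) : 0 ≤ I.observe.pen i := by
  unfold Observation.pen
  split_ifs
  exacts [NNReal.coe_nonneg _, le_rfl]

theorem observe_take_dist {m : ℕ} (hm : m ≤ I.len) {p q : ℕ × Bool} (hp : p.1 < m)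
    (hq : q.1 < m) : (I.take m hm).observe.dist p q = I.observe.dist p q := by
  have h1 : p.1 < (I.take m hm).len ∧ q.1 < (I.take m hm).len := ⟨hp, hq⟩
  have h2 : p.1 < I.len ∧ q.1 < I.len := ⟨hp.trans_le hm, hq.trans_le hm⟩
  unfold Observation.dist
  rw [dif_pos h1, dif_pos h2]
  obtain ⟨i, b⟩ := p
  obtain ⟨j, c⟩ := q
  cases b <;> cases c <;> rfl

theorem observe_take_pen {m : ℕ} (hm : m ≤ I.len) {i : ℕ} (hi : i < m) :
    (I.take m hm).observe.pen i = I.observe.pen i := by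
  have h1 : i < (I.take m hm).len := hi
  unfold Observation.pen
  rw [dif_pos h1, dif_pos (hi.trans_le hm)]
  rfl

/-- The state after the first `m` requests. -/
def stateAt (m : ℕ) (hm : m ≤ I.len) : ClusterState := run m (I.take m hm).observe

theorem init_observe_take {m : ℕ} (hm : m + 1 ≤ I.len) :
    Observation.init (n := m) (I.take (m + 1) hm).observe =
      (I.take m (m.le_succ.trans hm)).observe := by
  unfold Observation.init Instance.observe
  congr 1
  funext ⟨i, b⟩ ⟨j, c⟩
  cases b <;> cases c <;> rfl

theorem Invariant.validStep_stateAt {m : ℕ} (hm : m + 1 ≤ I.len)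
    (h : Invariant I.observe.dist I.observe.pen m (stateAt I m (m.le_succ.trans hm)))
    (ht : (stateAt I m (m.le_succ.trans hm)).Tight) :
    ValidStep (I.take (m + 1) hm).observe.dist (I.take (m + 1) hm).observe.pen m
      (stateAt I m (m.le_succ.trans hm)) (stateAt I (m + 1) hm) := by
  have h1 := h.congr (D' := (I.take (m + 1) hm).observe.dist)
    (pen' := (I.take (m + 1) hm).observe.pen)
    (fun p q hp hq => (observe_take_dist I hm (hp.trans m.lt_succ_self)
      (hq.trans m.lt_succ_self)).symm)
    (fun i hi => (observe_take_pen I hm (hi.trans m.lt_succ_self)).symm)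
  have h2 : ∃ τ, ValidStep (I.take (m + 1) hm).observe.dist (I.take (m + 1) hm).observe.pen m
      (run m (Observation.init (n := m) (I.take (m + 1) hm).observe)) τ := by
    rw [init_observe_take]
    exact h1.exists_validStep ht (observe_pen_nonneg _) (observe_dist_nonneg _)
  have h3 : stateAt I (m + 1) hm = h2.choose := dif_pos h2
  have h4 := h2.choose_spec
  rw [← h3, init_observe_take] at h4
  exact h4

theorem stateAt_spec (m : ℕ) (hm : m ≤ I.len) :
    Invariant I.observe.dist I.observe.pen m (stateAt I m hm) ∧ (stateAt I m hm).Tight := by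
  induction m with
  | zero => exact ⟨Invariant.initial _ _, fun a ha => by simp [stateAt, run, initial] at ha⟩
  | succ m ih =>
    obtain ⟨h1, h2⟩ := ih (m.le_succ.trans hm)
    have h3 := h1.validStep_stateAt I hm h2
    exact ⟨h3.invariant.congr (fun p q hp hq => observe_take_dist I hm hp hq)
      fun i hi => observe_take_pen I hm hi, h3.tight⟩

theorem stateAt_extends {m m' : ℕ} (h : m ≤ m') (hm : m' ≤ I.len) :
    (stateAt I m (h.trans hm)).Extends (stateAt I m' hm) := by
  induction m', h using Nat.le_induction with
  | base => exact Extends.refl _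
  | succ k hk ih =>
    obtain ⟨h1, h2⟩ := stateAt_spec I k (k.le_succ.trans hm)
    exact (ih _).trans (h1.validStep_stateAt I hm h2).ext

theorem stateAt_served {m : ℕ} (hm : m + 1 ≤ I.len) :
    I.observe.dist (m, false) (m, true) = 0 ∨ m ∈ (stateAt I (m + 1) hm).paid ∨
      (stateAt I (m + 1) hm).Joined (m, false) (m, true) := by
  obtain ⟨h1, h2⟩ := stateAt_spec I m (m.le_succ.trans hm)
  have h3 := (h1.validStep_stateAt I hm h2).served
  rwa [observe_take_dist I hm (by exact m.lt_succ_self) (by exact m.lt_succ_self)] at h3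

theorem observe_dist_eq (v : V) {p q : ℕ × Bool} (hp : p.1 < I.len) (hq : q.1 < I.len) :
    I.observe.dist p q = dist (place I v p) (place I v q) := by
  rw [place_of_lt I v hp, place_of_lt I v hq]
  exact dif_pos ⟨hp, hq⟩

open Classical in
theorem bought_eq (v : V) (i : Fin I.len) :
    clusterAlgorithm.bought I i =
      (stateAt I (i + 1) i.isLt).edges.image fun e => s(place I v e.1, place I v e.2) := by
  have h := (stateAt_spec I (i + 1) i.isLt).1
  have hplace : ∀ p : ℕ × Bool, p.1 < i + 1 →
      (I.take (i + 1) i.isLt).terminal (toFin i p) = place I v p := by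
    rintro ⟨k, c⟩ hk
    have hk' : Fin.ofNat ((i : ℕ) + 1) k = ⟨k, hk⟩ := Fin.ext (Nat.mod_eq_of_lt hk)
    rw [place_of_lt I v (p := (k, c)) (by dsimp only at hk ⊢; omega)]
    cases c
    · change (I.take (i + 1) i.isLt).s (Fin.ofNat ((i : ℕ) + 1) k) = _
      rw [hk']; rfl
    · change (I.take (i + 1) i.isLt).t (Fin.ofNat ((i : ℕ) + 1) k) = _
      rw [hk']; rfl
  change ((stateAt I (i + 1) i.isLt).edges.image fun e => s(toFin i e.1, toFin i e.2)).image
    (Sym2.map (I.take (i + 1) i.isLt).terminal) = _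
  refine Finset.image_image.trans (Finset.image_congr fun e he => ?_)
  have hlt := h.edges_lt e he
  exact congrArg₂ (fun x y => s(x, y)) (hplace _ hlt.1) (hplace _ hlt.2)

open Classical in
theorem subgraph_eq (v : V) (m : ℕ) (hm : m ≤ I.len) :
    clusterAlgorithm.subgraph I m =
      (stateAt I m hm).edges.image fun e => s(place I v e.1, place I v e.2) := by
  apply Finset.Subset.antisymm
  · intro e he
    obtain ⟨i, hi, he⟩ := Finset.mem_biUnion.1 he
    rw [bought_eq I v] at he
    exact Finset.image_subset_image
      (stateAt_extends I (Finset.mem_filter.1 hi).2 hm).edges he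
  · cases m with
    | zero => simp [stateAt, run, ClusterState.initial]
    | succ k =>
      intro e he
      refine Finset.mem_biUnion.2 ⟨⟨k, hm⟩, ?_, ?_⟩
      · exact Finset.mem_filter.2 ⟨Finset.mem_univ _, k.lt_succ_self⟩
      · rw [bought_eq I v]
        exact he

theorem mem_paid_iff (i : Fin I.len) :
    i ∈ clusterAlgorithm.paid I ↔ (i : ℕ) ∈ (stateAt I (i + 1) i.isLt).paid := by
  simp only [OnlineAlgorithm.paid, Finset.mem_filter, Finset.mem_univ, true_and]
  exact decide_eq_true_iff

theorem clusterAlgorithm_isFeasible : clusterAlgorithm.IsFeasible I := by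
  intro i hi
  rw [mem_paid_iff] at hi
  have hs : place I (I.s i) (i, false) = I.s i := place_of_lt I _ i.isLt
  have ht : place I (I.s i) (i, true) = I.t i := place_of_lt I _ i.isLt
  rcases stateAt_served I i.isLt with h | h | h
  · rw [observe_dist_eq I (I.s i) (by exact i.isLt) (by exact i.isLt), hs, ht] at h
    rw [dist_eq_zero.1 h]
    exact SimpleGraph.Reachable.refl _
  · exact absurd h hi
  · rw [subgraph_eq I (I.s i) _ i.isLt]
    have := Joined.connects h (place I (I.s i))
    rwa [hs, ht] at this

theorem edgeLength_nonneg (e : Sym2 V) : 0 ≤ edgeLength e := by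
  induction e with
  | h u v => exact dist_nonneg

theorem sum_requestSum_le {D : ℕ × Bool → ℕ × Bool → ℝ} {pen : ℕ → ℝ} {m : ℕ}
    {σ : ClusterState} (h : Invariant D pen m σ) (S : Finset ℕ) :
    ∑ i ∈ S, σ.requestSum i ≤ ∑ e ∈ σ.charges, σ.amount e := by
  unfold ClusterState.requestSum
  rw [← Finset.sum_fiberwise_of_maps_to (t := σ.charges.image (·.1.1) ∪ S)
    (g := fun e : (ℕ × Bool) × ℤ => e.1.1) (fun e he => Finset.mem_union_left _ (Finset.mem_image_of_mem _ he))]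
  exact Finset.sum_le_sum_of_subset_of_nonneg Finset.subset_union_right
    fun i _ _ => h.requestSum_nonneg i

/-- The total charge is counted twice: the credit inequality bounds the edges by it, and each paid
penalty is covered by the charges of its own request. -/
theorem clusterAlgorithm_cost_le :
    clusterAlgorithm.cost I ≤ allowance I.observe.dist I.observe.pen I.len +
      2 * ∑ e ∈ (stateAt I I.len le_rfl).charges, (stateAt I I.len le_rfl).amount e := by
  classical
  have h := (stateAt_spec I I.len le_rfl).1
  set σ := stateAt I I.len le_rfl
  have hedges : edgeCost (clusterAlgorithm.subgraph I I.len) ≤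
      ∑ e ∈ σ.edges, I.observe.dist e.1 e.2 := by
    -- Without requests the space may be empty, and `place` would have no default point.
    rcases Nat.eq_zero_or_pos I.len with h0 | hpos
    · have : clusterAlgorithm.subgraph I I.len = ∅ := by
        refine Finset.eq_empty_of_forall_notMem fun e he => ?_
        obtain ⟨i, _, _⟩ := Finset.mem_biUnion.1 he
        exact absurd i.isLt (by omega)
      rw [this]
      exact (Finset.sum_empty).trans_le (Finset.sum_nonneg fun _ _ => observe_dist_nonneg I _ _)
    · have v : V := I.s ⟨0, hpos⟩
      rw [subgraph_eq I v I.len le_rfl]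
      unfold edgeCost
      refine (Finset.sum_image_le_of_nonneg ?_).trans_eq ?_
      · exact fun e _ => edgeLength_nonneg e
      · refine Finset.sum_congr rfl fun e he => ?_
        rw [observe_dist_eq I v (h.edges_lt e he).1 (h.edges_lt e he).2]
        rfl
  have hpaid : ∑ i ∈ clusterAlgorithm.paid I, (I.penalty i : ℝ) ≤
      ∑ e ∈ σ.charges, σ.amount e := by
    refine le_trans ?_ (sum_requestSum_le h ((clusterAlgorithm.paid I).image Fin.val))
    rw [Finset.sum_image (fun _ _ _ _ h => Fin.ext h)]
    refine Finset.sum_le_sum fun i hi => ?_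
    have h1 := (stateAt_extends I i.isLt le_rfl).paid ((mem_paid_iff I i).1 hi)
    have h2 := h.paid_le i h1
    unfold Observation.pen at h2
    rw [dif_pos i.isLt] at h2
    exact h2
  have h1 : 0 ≤ ∑ a ∈ σ.live, (2 : ℝ) ^ σ.level a := Finset.sum_nonneg fun _ _ => by positivity
  have h2 : 0 ≤ σ.openSum :=
    Finset.sum_nonneg fun e he => h.amount_nonneg e (Finset.mem_filter.1 he).1
  have h3 := h.credit
  unfold OnlineAlgorithm.cost Instance.solutionCost
  linarith

end Run

/-! ### Lower bounds on the cost of a solution -/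

section LowerBound

variable {V : Type*}

/-- The variation of a function along an edge. -/
def jump (g : V → ℝ) : Sym2 V → ℝ :=
  Sym2.lift ⟨fun u v => |g u - g v|, fun u v => abs_sub_comm (g u) (g v)⟩

theorem jump_nonneg (g : V → ℝ) (e : Sym2 V) : 0 ≤ jump g e := by
  induction e with
  | h u v => exact abs_nonneg _

theorem abs_sub_le_sum_edges (g : V → ℝ) {G : SimpleGraph V} {u v : V} (w : G.Walk u v) :
    |g u - g v| ≤ (w.edges.map (jump g)).sum := by
  induction w with
  | nil => simp
  | @cons a b c h w ih =>
    simp only [SimpleGraph.Walk.edges_cons, List.map_cons, List.sum_cons]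
    exact (abs_sub_le (g a) (g b) (g c)).trans (add_le_add le_rfl ih)

/-- A path uses every edge at most once, so its total variation is bounded by the sum over the edge
set. -/
theorem Connects.abs_sub_le {F : Finset (Sym2 V)} {u v : V} (h : Connects F u v) (g : V → ℝ) :
    |g u - g v| ≤ ∑ e ∈ F, jump g e := by
  classical
  obtain ⟨w, hw⟩ := h.exists_isPath
  refine (abs_sub_le_sum_edges g w).trans ?_
  rw [← List.sum_toFinset _ hw.isTrail.edges_nodup]
  refine Finset.sum_le_sum_of_subset_of_nonneg (fun e he => ?_) fun e _ _ => jump_nonneg g e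
  have := w.edges_subset_edgeSet (List.mem_toFinset.1 he)
  rw [SimpleGraph.edgeSet_fromEdgeSet] at this
  exact Finset.mem_coe.1 this.1

variable [MetricSpace V]

theorem edgeCost_nonneg (F : Finset (Sym2 V)) : 0 ≤ edgeCost F :=
  Finset.sum_nonneg fun e _ => edgeLength_nonneg e

theorem Connects.dist_le {F : Finset (Sym2 V)} {u v : V} (h : Connects F u v) :
    dist u v ≤ edgeCost F := by
  have h1 := h.abs_sub_le (dist u)
  rw [dist_self, zero_sub, abs_neg, abs_of_nonneg dist_nonneg] at h1
  refine h1.trans (Finset.sum_le_sum fun e _ => ?_)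
  induction e with
  | h a b =>
    change |dist u a - dist u b| ≤ dist a b
    rw [dist_comm u a, dist_comm u b]
    exact abs_dist_sub_le a b u

/-- The truncated distance is 1-Lipschitz and constant outside the ball, so an edge matters only if
one of its ends lies in the ball. -/
theorem abs_min_dist_sub_le (w u v : V) (R : ℝ) :
    |min (dist w u) R - min (dist w v) R| ≤
      (if dist w u < R then dist u v else 0) + if dist w v < R then dist u v else 0 := by
  have h1 : |min (dist w u) R - min (dist w v) R| ≤ dist u v := by
    refine (abs_min_sub_min_le_max _ _ _ _).trans ?_
    rw [sub_self, abs_zero, max_eq_left (abs_nonneg _), dist_comm w u, dist_comm w v]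
    exact abs_dist_sub_le u v w
  have h2 : 0 ≤ dist u v := dist_nonneg
  split_ifs with hu hv hv
  · linarith
  · linarith
  · linarith
  · rw [min_eq_right (not_lt.1 hu), min_eq_right (not_lt.1 hv)]
    simp

/-- Disjoint balls that a subgraph has to leave have a total radius of at most twice its cost. -/
theorem mul_card_le_edgeCost {ι : Type*} (W : Finset ι) (x : ι → V) {R : ℝ}
    (hsep : ∀ a ∈ W, ∀ b ∈ W, a ≠ b → 2 * R < dist (x a) (x b)) {F : Finset (Sym2 V)}
    (hF : ∀ a ∈ W, ∃ t, Connects F (x a) t ∧ R ≤ dist (x a) t) (hR : 0 ≤ R) :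
    R * W.card ≤ 2 * edgeCost F := by
  -- The balls are disjoint, so a point lies in at most one. Applied to both ends of an edge, this
  -- gives the factor 2.
  have hball : ∀ (u : V) (d : ℝ), 0 ≤ d → ∑ a ∈ W, (if dist (x a) u < R then d else 0) ≤ d := by
    intro u d hd
    rw [← Finset.sum_filter, Finset.sum_const, nsmul_eq_mul]
    refine mul_le_of_le_one_left hd ?_
    have : ({a ∈ W | dist (x a) u < R}).card ≤ 1 := by
      refine Finset.card_le_one.2 fun a ha b hb => ?_
      rw [Finset.mem_filter] at ha hb
      by_contra hne
      have h1 := hsep a ha.1 b hb.1 hne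
      have h2 := dist_triangle_right (x a) (x b) u
      linarith [ha.2, hb.2]
    exact_mod_cast this
  calc R * W.card = ∑ a ∈ W, R := by rw [Finset.sum_const, nsmul_eq_mul, mul_comm]
    _ ≤ ∑ a ∈ W, ∑ e ∈ F, jump (fun y => min (dist (x a) y) R) e := by
        refine Finset.sum_le_sum fun a ha => ?_
        obtain ⟨t, ht, hRt⟩ := hF a ha
        refine le_trans ?_ (ht.abs_sub_le fun y => min (dist (x a) y) R)
        rw [dist_self, min_eq_left hR, min_eq_right hRt, zero_sub, abs_neg]
        exact le_abs_self R
    _ = ∑ e ∈ F, ∑ a ∈ W, jump (fun y => min (dist (x a) y) R) e := Finset.sum_comm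
    _ ≤ ∑ e ∈ F, 2 * edgeLength e := by
        refine Finset.sum_le_sum fun e _ => ?_
        induction e with
        | h u v =>
          refine (Finset.sum_le_sum fun a _ => abs_min_dist_sub_le (x a) u v R).trans ?_
          rw [Finset.sum_add_distrib, two_mul]
          change _ ≤ dist u v + dist u v
          exact add_le_add (hball u (dist u v) dist_nonneg) (hball v (dist u v) dist_nonneg)
    _ = 2 * edgeCost F := by rw [← Finset.mul_sum]; rfl

end LowerBound

/-! ### Bounds on the charges -/

section Charges

variable {D : ℕ × Bool → ℕ × Bool → ℝ} {pen : ℕ → ℝ} {m : ℕ} {σ : ClusterState}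

theorem Invariant.sum_amount_le_card (h : Invariant D pen m σ) (j : ℤ)
    {S : Finset ((ℕ × Bool) × ℤ)} (hS : S ⊆ σ.charges) (hj : ∀ e ∈ S, e.2 = j) :
    ∑ e ∈ S, σ.amount e ≤ (S.image σ.atom).card * (2 * 2 ^ j) := by
  rw [← Finset.sum_fiberwise_of_maps_to (t := S.image σ.atom) (g := σ.atom)
    fun e he => Finset.mem_image_of_mem _ he, ← nsmul_eq_mul]
  refine Finset.sum_le_card_nsmul _ _ _ fun a _ => ?_
  refine le_trans ?_ (h.atomSum_le a j)
  refine Finset.sum_le_sum_of_subset_of_nonneg (fun e he => ?_)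
    fun e he _ => h.amount_nonneg e (Finset.mem_filter.1 he).1
  rw [Finset.mem_filter] at he ⊢
  exact ⟨hS he.1, hj e he.1, he.2⟩

variable {V : Type*} [MetricSpace V] {x : ℕ × Bool → V}

/-- Representatives of different moats are at positive distance, hence at different locations. -/
theorem Invariant.card_atoms_le (h : Invariant D pen m σ)
    (hx : ∀ p q, p.1 < m → q.1 < m → D p q = dist (x p) (x q)) {j : ℤ}
    {T : Finset V} (hT : ∀ p, p.1 < m → x p ∈ T) {S : Finset ((ℕ × Bool) × ℤ)}
    (hS : S ⊆ σ.charges) (hj : ∀ e ∈ S, e.2 = j) : (S.image σ.atom).card ≤ T.card := by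
  have hlt : ∀ e ∈ S, e.1.1 < m := fun e he => h.arrived_lt _ (h.charge_arrived e (hS he))
  have hw : ∀ a ∈ S.image σ.atom, ∃ e, e ∈ S ∧ σ.atom e = a := fun a ha =>
    Finset.mem_image.1 ha
  choose! w hw using hw
  refine Finset.card_le_card_of_injOn (fun a => x (w a).1)
    (fun a ha => hT _ (hlt _ (hw a ha).1)) fun a ha b hb hab => ?_
  by_contra hne
  have h1 := hw a ha
  have h2 := hw b hb
  have h3 := h.separated _ (hS h1.1) _ (hS h2.1) ((hj _ h1.1).trans (hj _ h2.1).symm)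
    (by rw [h1.2, h2.2]; exact hne)
  rw [hx _ _ (hlt _ h1.1) (hlt _ h2.1)] at h3
  dsimp only at hab
  rw [hab, dist_self] at h3
  exact absurd h3 (not_lt.2 (by positivity))

/-- One representative per moat gives disjoint balls of radius 2^j/2, and `far` puts the partner of
each representative outside its ball. -/
theorem Invariant.card_atoms_le_edgeCost (h : Invariant D pen m σ)
    (hx : ∀ p q, p.1 < m → q.1 < m → D p q = dist (x p) (x q)) {j : ℤ}
    {F : Finset (Sym2 V)} {S : Finset ((ℕ × Bool) × ℤ)} (hS : S ⊆ σ.charges)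
    (hj : ∀ e ∈ S, e.2 = j) (hF : ∀ e ∈ S, Connects F (x (e.1.1, false)) (x (e.1.1, true))) :
    (S.image σ.atom).card * (2 : ℝ) ^ j ≤ 4 * edgeCost F := by
  have hlt : ∀ e ∈ S, e.1.1 < m := fun e he => h.arrived_lt _ (h.charge_arrived e (hS he))
  have hw : ∀ a ∈ S.image σ.atom, ∃ e, e ∈ S ∧ σ.atom e = a := fun a ha =>
    Finset.mem_image.1 ha
  choose! w hw using hw
  have hpow : (0 : ℝ) < 2 ^ j := by positivity
  have key := mul_card_le_edgeCost (S.image σ.atom) (fun a => x (w a).1) (R := 2 ^ j / 2)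
    (F := F) ?_ ?_ (by positivity)
  · linarith
  · intro a ha b hb hne
    have h1 := hw a ha
    have h2 := hw b hb
    have h3 := h.separated _ (hS h1.1) _ (hS h2.1) ((hj _ h1.1).trans (hj _ h2.1).symm)
      (by rw [h1.2, h2.2]; exact hne)
    rw [hx _ _ (hlt _ h1.1) (hlt _ h2.1), hj _ h1.1] at h3
    linarith
  · intro a ha
    have h1 := hw a ha
    have h3 := h.far _ (hS h1.1)
    rw [hx _ _ (hlt _ h1.1) (by exact hlt _ h1.1), hj _ h1.1] at h3
    refine ⟨x (partner (w a).1), ?_, by linarith⟩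
    have h4 := hF _ h1.1
    generalize w a = e at h4 ⊢
    obtain ⟨⟨i, c⟩, k⟩ := e
    cases c
    exacts [h4, h4.symm]

/-- A terminal has at most one charge per level, of at most its penalty; a request has two
terminals. -/
theorem Invariant.sum_amount_le_penalties (h : Invariant D pen m σ) (hpen : ∀ i, 0 ≤ pen i)
    {j : ℤ} {Q : Finset ℕ} {S : Finset ((ℕ × Bool) × ℤ)} (hS : S ⊆ σ.charges)
    (hj : ∀ e ∈ S, e.2 = j) (hQ : ∀ e ∈ S, e.1.1 ∈ Q) :
    ∑ e ∈ S, σ.amount e ≤ 2 * ∑ i ∈ Q, pen i := by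
  calc ∑ e ∈ S, σ.amount e ≤ ∑ e ∈ S, pen e.1.1 :=
        Finset.sum_le_sum fun e he => h.amount_le e (hS he)
    _ = ∑ p ∈ S.image Prod.fst, pen p.1 := by
        rw [Finset.sum_image]
        intro e he f hf hef
        exact Prod.ext hef ((hj e he).trans (hj f hf).symm)
    _ ≤ ∑ p ∈ Q ×ˢ (Finset.univ : Finset Bool), pen p.1 := by
        refine Finset.sum_le_sum_of_subset_of_nonneg (fun p hp => ?_) fun p _ _ => hpen p.1
        obtain ⟨e, he, rfl⟩ := Finset.mem_image.1 hp
        exact Finset.mem_product.2 ⟨hQ e he, Finset.mem_univ _⟩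
    _ = 2 * ∑ i ∈ Q, pen i := by
        rw [Finset.sum_product, Finset.mul_sum]
        exact Finset.sum_congr rfl fun i _ => by simp

/-- Charges of requests in `Q` are bounded by twice the penalties. The others lie in moats of at
most 2·2^j each, whose number times 2^j is at most 4 times the edge cost. -/
theorem Invariant.levelSum_le (h : Invariant D pen m σ) (hpen : ∀ i, 0 ≤ pen i)
    (hx : ∀ p q, p.1 < m → q.1 < m → D p q = dist (x p) (x q)) {F : Finset (Sym2 V)}
    {Q : Finset ℕ} (hFQ : ∀ i < m, i ∉ Q → Connects F (x (i, false)) (x (i, true))) (j : ℤ) :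
    σ.levelSum j ≤ 8 * (edgeCost F + ∑ i ∈ Q, pen i) := by
  have hQ0 : 0 ≤ ∑ i ∈ Q, pen i := Finset.sum_nonneg fun i _ => hpen i
  unfold ClusterState.levelSum
  rw [← Finset.sum_filter_add_sum_filter_not _ fun e : (ℕ × Bool) × ℤ => e.1.1 ∈ Q]
  have hsub := Finset.filter_subset (fun e : (ℕ × Bool) × ℤ => e.2 = j) σ.charges
  have h1 := h.sum_amount_le_penalties hpen (j := j) (Q := Q)
    ((Finset.filter_subset (fun e => e.1.1 ∈ Q) _).trans hsub)
    (fun e he => (Finset.mem_filter.1 (Finset.mem_filter.1 he).1).2)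
    (fun e he => (Finset.mem_filter.1 he).2)
  have hS := (Finset.filter_subset (fun e => e.1.1 ∉ Q) _).trans hsub
  have hj : ∀ e ∈ {e ∈ {e ∈ σ.charges | e.2 = j} | e.1.1 ∉ Q}, e.2 = j :=
    fun e he => (Finset.mem_filter.1 (Finset.mem_filter.1 he).1).2
  have h2 := h.sum_amount_le_card j hS hj
  have h3 := h.card_atoms_le_edgeCost hx (F := F) hS hj fun e he =>
    hFQ _ (h.arrived_lt _ (h.charge_arrived e (hS he))) (Finset.mem_filter.1 he).2
  linarith

theorem threshold_le_cost (hpen : ∀ i, 0 ≤ pen i)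
    (hx : ∀ p q, p.1 < m → q.1 < m → D p q = dist (x p) (x q)) {F : Finset (Sym2 V)}
    {Q : Finset ℕ} (hFQ : ∀ i < m, i ∉ Q → Connects F (x (i, false)) (x (i, true)))
    {i : ℕ} (hi : i < m) : threshold D pen i ≤ edgeCost F + ∑ i ∈ Q, pen i := by
  have h1 := edgeCost_nonneg F
  have hQ0 : 0 ≤ ∑ i ∈ Q, pen i := Finset.sum_nonneg fun i _ => hpen i
  by_cases hiQ : i ∈ Q
  · have h2 := Finset.single_le_sum (fun i _ => hpen i) hiQ
    exact (min_le_left _ _).trans (by linarith)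
  · refine (min_le_right _ _).trans ?_
    rw [hx _ _ (by exact hi) (by exact hi)]
    linarith [(hFQ i hi hiQ).dist_le]

theorem Invariant.two_zpow_le_cost (h : Invariant D pen m σ) (hpen : ∀ i, 0 ≤ pen i)
    (hx : ∀ p q, p.1 < m → q.1 < m → D p q = dist (x p) (x q)) {F : Finset (Sym2 V)}
    {Q : Finset ℕ} (hFQ : ∀ i < m, i ∉ Q → Connects F (x (i, false)) (x (i, true)))
    {e : (ℕ × Bool) × ℤ} (he : e ∈ σ.charges) :
    (2 : ℝ) ^ e.2 ≤ 16 * (edgeCost F + ∑ i ∈ Q, pen i) := by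
  have h1 := edgeCost_nonneg F
  have hQ0 : 0 ≤ ∑ i ∈ Q, pen i := Finset.sum_nonneg fun i _ => hpen i
  rcases h.charge_reason e he with ⟨i, hi, h2⟩ | h2
  · linarith [threshold_le_cost hpen hx hFQ hi]
  · have h3 := h.levelSum_le hpen hx hFQ (e.2 - 1)
    rw [zpow_sub_one₀ (by norm_num)] at h2
    linarith

/-! ### Summation over the levels -/

theorem sum_half_pow_le (S : Finset ℕ) : ∑ i ∈ S, (1 / 2 : ℝ) ^ i ≤ 2 :=
  (summable_geometric_two.sum_le_tsum S fun _ _ => by positivity).trans_eq tsum_geometric_two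

theorem sum_two_zpow_le (a : ℤ) {L : Finset ℤ} (hL : ∀ j ∈ L, j ≤ a) :
    ∑ j ∈ L, (2 : ℝ) ^ j ≤ 2 * 2 ^ a := by
  have h1 : ∑ j ∈ L, (2 : ℝ) ^ j = 2 ^ a * ∑ i ∈ L.image fun j => (a - j).toNat,
      (1 / 2 : ℝ) ^ i := by
    rw [Finset.sum_image, Finset.mul_sum]
    · refine Finset.sum_congr rfl fun j hj => ?_
      have := hL j hj
      rw [one_div, inv_pow, ← zpow_natCast, ← zpow_neg, ← zpow_add₀ (by norm_num)]
      congr 1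
      omega
    · intro i hi j hj hij
      have h2 := hL i hi
      have h3 := hL j hj
      dsimp only at hij
      omega
  rw [h1, mul_comm]
  exact mul_le_mul_of_nonneg_right (sum_half_pow_le _) (by positivity)

/-- Quantities that decay geometrically below a bounded range of `O(log k)` levels. -/
theorem sum_levels_le {X : ℝ} (hX : 0 ≤ X) {k : ℕ} (hk : 2 ≤ k) {L : Finset ℤ} {f : ℤ → ℝ}
    (hf : ∀ j ∈ L, f j ≤ 8 * X) (hfk : ∀ j ∈ L, f j ≤ k * (2 * 2 ^ j))
    (hL : ∀ j ∈ L, (2 : ℝ) ^ j ≤ 16 * X) :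
    ∑ j ∈ L, f j ≤ 52 * (Real.log k / Real.log 2) * X := by
  have hlog2 : 0 < Real.log 2 := Real.log_pos one_lt_two
  have hk' : (2 : ℝ) ≤ k := by exact_mod_cast hk
  have hr : 1 ≤ Real.log k / Real.log 2 := by
    rw [one_le_div hlog2]
    exact Real.log_le_log two_pos hk'
  rcases hX.eq_or_lt with rfl | hX
  · have : L = ∅ := Finset.eq_empty_of_forall_notMem fun j hj => by
      have h1 := hL j hj
      have h2 : (0 : ℝ) < 2 ^ j := by positivity
      linarith
    simp [this]
  -- The cutoff 2^a ≈ X/k: up to level `a` the bound by the number of terminals gives a geometric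
  -- series; above it the uniform bound 8X is used.
  obtain ⟨a, ha, ha'⟩ := exists_mem_Ico_zpow (x := X / k) (y := 2) (by positivity) one_lt_two
  rw [le_div_iff₀ (by positivity)] at ha
  rw [div_lt_iff₀ (by positivity)] at ha'
  have hclog : ((Nat.clog 2 k : ℕ) : ℝ) ≤ Real.log k / Real.log 2 + 1 := by
    have h1 := Nat.pow_pred_clog_lt_self one_lt_two (x := k) (by omega)
    have h2 : ((2 : ℝ) ^ (Nat.clog 2 k).pred) ≤ k := by exact_mod_cast h1.le
    have h3 := Real.log_le_log (by positivity) h2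
    rw [Real.log_pow, ← le_div_iff₀ hlog2] at h3
    have h4 : ((Nat.clog 2 k : ℕ) : ℝ) ≤ (Nat.clog 2 k).pred + 1 := by
      exact_mod_cast Nat.le_add_one_iff.2 (by simp only [Nat.pred_eq_sub_one]; omega)
    linarith
  rw [← Finset.sum_filter_add_sum_filter_not L fun j => j ≤ a]
  have hlow : ∑ j ∈ L with j ≤ a, f j ≤ 4 * X := by
    calc ∑ j ∈ L with j ≤ a, f j ≤ ∑ j ∈ L with j ≤ a, k * (2 * (2 : ℝ) ^ j) :=
          Finset.sum_le_sum fun j hj => hfk j (Finset.mem_filter.1 hj).1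
      _ = k * (2 * ∑ j ∈ L with j ≤ a, (2 : ℝ) ^ j) := by
          rw [Finset.mul_sum, Finset.mul_sum]
      _ ≤ k * (2 * (2 * 2 ^ a)) := by
          gcongr
          exact sum_two_zpow_le a fun j hj => (Finset.mem_filter.1 hj).2
      _ ≤ 4 * X := by linarith
  have hcard : ((({j ∈ L | ¬ j ≤ a}).card : ℕ) : ℝ) ≤ Nat.clog 2 k + 4 := by
    -- From 2^j ≤ 16X < 16·2^(a+1)·k it follows that j < a + 5 + clog k.
    have hsub : {j ∈ L | ¬ j ≤ a} ⊆ Finset.Ioc a (a + (Nat.clog 2 k + 4 : ℕ)) := by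
      intro j hj
      rw [Finset.mem_filter] at hj
      rw [Finset.mem_Ioc]
      refine ⟨not_le.1 hj.2, ?_⟩
      have h1 : (k : ℝ) ≤ 2 ^ Nat.clog 2 k := by
        exact_mod_cast Nat.le_pow_clog one_lt_two k
      have h2 : (2 : ℝ) ^ j < 2 ^ (a + 1 + 4 + (Nat.clog 2 k : ℤ)) := by
        rw [zpow_add₀ (by norm_num), zpow_add₀ (by norm_num) (a + 1), zpow_natCast]
        calc (2 : ℝ) ^ j ≤ 16 * X := hL j hj.1
          _ < 16 * (2 ^ (a + 1) * k) := by gcongr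
          _ ≤ 16 * (2 ^ (a + 1) * 2 ^ Nat.clog 2 k) := by gcongr
          _ = _ := by norm_num; ring
      have h3 := (zpow_lt_zpow_iff_right₀ (by norm_num : (1 : ℝ) < 2)).1 h2
      push_cast
      omega
    have := Finset.card_le_card hsub
    rw [Int.card_Ioc] at this
    have h2 : ({j ∈ L | ¬ j ≤ a}).card ≤ Nat.clog 2 k + 4 := by omega
    exact_mod_cast h2
  have hhigh : ∑ j ∈ L with ¬ j ≤ a, f j ≤ (Nat.clog 2 k + 4) * (8 * X) := by
    refine (Finset.sum_le_card_nsmul _ _ (8 * X)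
      fun j hj => hf j (Finset.mem_filter.1 hj).1).trans ?_
    rw [nsmul_eq_mul]
    gcongr
  have h5 : ((Nat.clog 2 k : ℕ) + 4) * (8 * X) ≤ (Real.log k / Real.log 2 + 5) * (8 * X) :=
    mul_le_mul_of_nonneg_right (by linarith) (by positivity)
  -- With r = log k / log 2 the total is at most 4X + 8(r + 5)X, which is at most 52rX because r ≥
  -- 1.
  nlinarith

theorem Invariant.sum_amount_le (h : Invariant D pen m σ) (hpen : ∀ i, 0 ≤ pen i)
    (hx : ∀ p q, p.1 < m → q.1 < m → D p q = dist (x p) (x q)) {F : Finset (Sym2 V)}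
    {Q : Finset ℕ} (hFQ : ∀ i < m, i ∉ Q → Connects F (x (i, false)) (x (i, true)))
    {T : Finset V} (hT : ∀ p, p.1 < m → x p ∈ T) (hk : 2 ≤ T.card) :
    ∑ e ∈ σ.charges, σ.amount e ≤
      52 * (Real.log T.card / Real.log 2) * (edgeCost F + ∑ i ∈ Q, pen i) := by
  rw [← Finset.sum_fiberwise_of_maps_to (t := σ.charges.image Prod.snd) (g := Prod.snd)
    fun e he => Finset.mem_image_of_mem _ he]
  refine sum_levels_le
    (add_nonneg (edgeCost_nonneg F) (Finset.sum_nonneg fun i _ => hpen i)) hk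
    (fun j _ => h.levelSum_le hpen hx hFQ j) (fun j _ => ?_) fun j hj => ?_
  · have hS := Finset.filter_subset (fun e : (ℕ × Bool) × ℤ => e.2 = j) σ.charges
    have hj : ∀ e ∈ {e ∈ σ.charges | e.2 = j}, e.2 = j := fun e he => (Finset.mem_filter.1 he).2
    refine (h.sum_amount_le_card j hS hj).trans ?_
    have : (({e ∈ σ.charges | e.2 = j}.image σ.atom).card : ℝ) ≤ T.card := by
      exact_mod_cast h.card_atoms_le hx hT hS hj
    gcongr
  · obtain ⟨e, he, rfl⟩ := Finset.mem_image.1 hj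
    exact h.two_zpow_le_cost hpen hx hFQ he

theorem allowance_le {X : ℝ} (hX : 0 ≤ X) (hth : ∀ i < m, threshold D pen i ≤ X) :
    allowance D pen m ≤ 2 * X := by
  calc allowance D pen m ≤ ∑ i ∈ Finset.range m, X * (1 / 2) ^ i := by
        refine Finset.sum_le_sum fun i hi => ?_
        rw [pow_succ]
        have h1 := hth i (Finset.mem_range.1 hi)
        have h2 : (0 : ℝ) ≤ (1 / 2) ^ i := by positivity
        nlinarith
    _ = X * ∑ i ∈ Finset.range m, (1 / 2 : ℝ) ^ i := by rw [Finset.mul_sum]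
    _ ≤ X * 2 := mul_le_mul_of_nonneg_left (sum_half_pow_le _) hX
    _ = 2 * X := mul_comm _ _

end Charges

/-! ### The competitive ratio -/

section Ratio

variable {V : Type*} [MetricSpace V] (I : Instance V)

theorem clusterAlgorithm_cost_le_of_isSolution (hk : 2 ≤ I.numTerminals) {F : Finset (Sym2 V)}
    {P : Finset (Fin I.len)} (hFP : I.IsSolution F P) :
    clusterAlgorithm.cost I ≤
      106 / Real.log 2 * Real.log I.numTerminals * I.solutionCost F P := by
  classical
  have hpos : 0 < I.len := by
    by_contra hc
    have h0 : IsEmpty (Fin I.len × Bool) := ⟨fun p => hc (p.1.pos)⟩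
    rw [Instance.numTerminals, Finset.univ_eq_empty] at hk
    simp at hk
  have v : V := I.s ⟨0, hpos⟩
  have h := (stateAt_spec I I.len le_rfl).1
  have hx : ∀ p q : ℕ × Bool, p.1 < I.len → q.1 < I.len →
      I.observe.dist p q = dist (place I v p) (place I v q) := fun p q hp hq =>
    observe_dist_eq I v hp hq
  have hpen := observe_pen_nonneg I
  have hFQ : ∀ i < I.len, i ∉ P.image Fin.val →
      Connects F (place I v (i, false)) (place I v (i, true)) := by
    intro i hi hiP
    rw [place_of_lt I v (by exact hi), place_of_lt I v (by exact hi)]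
    exact hFP ⟨i, hi⟩ fun hc => hiP (Finset.mem_image_of_mem _ hc)
  have hQ : ∑ i ∈ P.image Fin.val, I.observe.pen i = ∑ i ∈ P, (I.penalty i : ℝ) := by
    rw [Finset.sum_image (fun _ _ _ _ h => Fin.ext h)]
    exact Finset.sum_congr rfl fun i _ => dif_pos i.isLt
  have hT : ∀ p : ℕ × Bool, p.1 < I.len → place I v p ∈ Finset.univ.image I.terminal := by
    intro p hp
    rw [place_of_lt I v hp]
    exact Finset.mem_image_of_mem _ (Finset.mem_univ _)
  have hcard : (Finset.univ.image I.terminal).card = I.numTerminals := by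
    unfold Instance.numTerminals
    congr!
  have h1 := h.sum_amount_le hpen hx hFQ hT (by rwa [hcard])
  have hX : 0 ≤ edgeCost F + ∑ i ∈ P.image Fin.val, I.observe.pen i :=
    add_nonneg (edgeCost_nonneg F) (Finset.sum_nonneg fun i _ => hpen i)
  have h2 := allowance_le hX fun i hi => threshold_le_cost hpen hx hFQ hi
  have h3 := clusterAlgorithm_cost_le I
  rw [hcard, hQ] at h1
  rw [hQ] at h2 hX
  have hr : 1 ≤ Real.log I.numTerminals / Real.log 2 := by
    rw [one_le_div (Real.log_pos one_lt_two)]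
    exact Real.log_le_log two_pos (by exact_mod_cast hk)
  unfold Instance.solutionCost
  rw [div_mul_eq_mul_div, mul_div_assoc]
  -- The constant is 106 = 2 + 2·52: the allowance gives 2X, absorbed by r ≥ 1, and the charges are
  -- counted twice.
  nlinarith

/-- With one location the logarithm vanishes, so the cost has to vanish too. All distances are 0,
which `far` excludes for a charge, so nothing is ever charged. -/
theorem clusterAlgorithm_cost_le_zero (hk : I.numTerminals ≤ 1) :
    clusterAlgorithm.cost I ≤ 0 := by
  classical
  have h := (stateAt_spec I I.len le_rfl).1
  have hD : ∀ p q, I.observe.dist p q = 0 := by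
    intro p q
    unfold Observation.dist
    split_ifs with hpq
    · rw [Instance.numTerminals, Finset.card_le_one] at hk
      exact dist_eq_zero.2 (hk _ (Finset.mem_image_of_mem _ (Finset.mem_univ _)) _
        (Finset.mem_image_of_mem _ (Finset.mem_univ _)))
    · rfl
  have hcharges : (stateAt I I.len le_rfl).charges = ∅ :=
    Finset.eq_empty_of_forall_notMem fun e he => by
      have h1 := h.far e he
      rw [hD] at h1
      exact absurd h1 (not_lt.2 (by positivity))
  have h1 := allowance_le (D := I.observe.dist) (pen := I.observe.pen) (m := I.len) le_rfl
    fun i _ => (min_le_right _ _).trans (hD _ _).le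
  have h2 := clusterAlgorithm_cost_le I
  rw [hcharges, Finset.sum_empty] at h2
  linarith

theorem clusterAlgorithm_cost_le_opt :
    clusterAlgorithm.cost I ≤ 106 / Real.log 2 * Real.log I.numTerminals * I.opt := by
  rcases Nat.lt_or_ge I.numTerminals 2 with hk | hk
  · have h0 : Real.log I.numTerminals = 0 := by
      interval_cases I.numTerminals <;> simp
    rw [h0, mul_zero, zero_mul]
    exact clusterAlgorithm_cost_le_zero I (by omega)
  · have hc : 0 < 106 / Real.log 2 * Real.log I.numTerminals :=
      mul_pos (div_pos (by norm_num) (Real.log_pos one_lt_two))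
        (Real.log_pos (by exact_mod_cast hk))
    rw [← div_le_iff₀' hc]
    -- Paying every penalty is a solution, so the infimum is over a nonempty set.
    refine le_csInf ⟨_, ∅, Finset.univ, fun i hi => absurd (Finset.mem_univ i) hi, rfl⟩ ?_
    rintro c ⟨F, P, hFP, rfl⟩
    rw [div_le_iff₀' hc]
    exact clusterAlgorithm_cost_le_of_isSolution I hk hFP

end Ratio

end PCSF

end

theorem theorem4 :
    ∃ (A : PCSF.OnlineAlgorithm) (C : ℝ),
      ∀ (V : Type*) [MetricSpace V] (I : PCSF.Instance V),
        A.IsFeasible I ∧ A.cost I ≤ C * Real.log (I.numTerminals : ℝ) * I.opt :=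
  ⟨PCSF.clusterAlgorithm, 106 / Real.log 2, fun _ _ I =>
    ⟨PCSF.clusterAlgorithm_isFeasible I, PCSF.clusterAlgorithm_cost_le_opt I⟩⟩
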